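/- There are a deterministic word-RAM program $P$ and constants $d,k\in\mathbb N$ and $c,C>0$ such that the following holds. Let $G=(V,E)$ be a finite simple bipartite graph with vertex set $V=\{0,\dots,n-1\}$, $m$ edges and maximum degree $\Delta$, and let $\chi:E\to\{1,\dots,\Delta\}\cup\{\bot\}$ be a valid partial coloring (no two distinct edges sharing a vertex receive the same color from $\{1,\dots,\Delta\}$) such that the set $U=\{e\in E:\chi(e)=\bot\}$ of uncolored edges is a matching. Given $n$, $m$ and a list of the edges of $G$ in arbitrary order, each edge with its two endpoints (in arbitrary order) and its color under $\chi$, the program $P$ extends $\chi$ to the edges in $U$: it changes the colors of some of the colored edges and assigns a color to every edge in $U$, and outputs the resulting valid coloring $\chi':E\to\{1,\dots,\Delta\}$. It halts after $\tilde O\bigl(m\cdot 2^{\Theta(\sqrt{\log\Delta})}\bigr)$ steps, namely after at most $$C\,(m+1)\cdot 2^{c\sqrt{\log\Delta}}\cdot(\log(m+2))^{k}$$ steps (with $\log\Delta$ read as $0$ when $\Delta=0$). Here $P$ runs on a word RAM whose word size $w$ is any integer with $2^w\ge (n+m+2)^d$. The machine has finitely many registers and finitely many arrays of $w$-bit words,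 initially $0$ outside the input. Reading or writing an array cell, copying a word, an addition, subtraction, multiplication, division or remainder of two words, and a comparison of two words each take one step. -/

import Mathlib

/-! ### Partial edge colorings -/

namespace EdgeColoring

variable {V : Type*} {G : SimpleGraph V} {μ : ℕ}

/-- A partial coloring of the edges of `G` with a palette of `μ` colors; `none` is "uncolored". -/
abbrev PartialColoring (G : SimpleGraph V) (μ : ℕ) : Type _ := G.edgeSet → Option (Fin μ)

/-- No two distinct edges that share a vertex receive the same color. -/
def Valid (χ : PartialColoring G μ) : Prop :=
  ∀ e f : G.edgeSet, e ≠ f → ∀ v : V, v ∈ (e : Sym2 V) → v ∈ (f : Sym2 V) →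
    ∀ a : Fin μ, χ e = some a → χ f ≠ some a

/-- The set of uncolored edges. -/
def uncolored (χ : PartialColoring G μ) : Set G.edgeSet := {e | χ e = none}

/-- A set of edges is a matching: no two distinct edges of it share a vertex. -/
def IsMatching (S : Set G.edgeSet) : Prop :=
  ∀ e ∈ S, ∀ f ∈ S, e ≠ f → ∀ v : V, v ∈ (e : Sym2 V) → v ∉ (f : Sym2 V)

/-- `χ'` is a result of extending `χ` to the set `S` of uncolored edges: the colored edges stay
colored (with a possibly different color), every edge of `S` gets a color, the remaining uncolored
edges stay uncolored, and the partial coloring obtained is valid. -/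
def IsExtension (χ : PartialColoring G μ) (S : Set G.edgeSet) (χ' : PartialColoring G μ) : Prop :=
  Valid χ' ∧ ∀ e, χ' e ≠ none ↔ χ e ≠ none ∨ e ∈ S

/-- The color of an edge as a number: `0` for an uncolored edge and `1, …, μ` for the colors. -/
def colorCode : Option (Fin μ) → ℕ
  | none => 0
  | some a => a + 1

/-- A listing of the `m` edges of a graph on `{0, …, n - 1}`, each edge exactly once, in an
arbitrary order and with its two endpoints in an arbitrary order. -/
structure EdgeListing {n : ℕ} (G : SimpleGraph (Fin n)) (m : ℕ) where
  edge : Fin m ≃ G.edgeSet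
  fst : Fin m → Fin n
  snd : Fin m → Fin n
  edge_eq : ∀ i, (edge i : Sym2 (Fin n)) = s(fst i, snd i)

end EdgeColoring

/-! ### The word RAM

A machine with word size `w` has registers and arrays of `w`-bit words (finitely many of each occur
in a program), and each primitive instruction and each test of a condition takes one step.
Programs are written with structured control flow. -/

namespace WordRAM

/-- The contents of the registers `reg x` and of the array cells `arr A i`. -/
structure State where
  reg : ℕ → ℕ
  arr : ℕ → ℕ → ℕ

/-- An operand of an instruction: a register or a literal. -/
inductive Operand where
  | reg (x : ℕ)
  | lit (k : ℕ)

/-- The value of an operand, for word size `w`. -/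
def Operand.val (w : ℕ) (s : State) : Operand → ℕ
  | .reg x => s.reg x
  | .lit k => k % 2 ^ w

/-- The arithmetic operations. -/
inductive Op where
  | add | sub | mul | div | mod

/-- The arithmetic operations on `w`-bit words; subtraction is cut off at `0`. -/
def Op.eval (w : ℕ) : Op → ℕ → ℕ → ℕ
  | .add, a, b => (a + b) % 2 ^ w
  | .sub, a, b => a - b
  | .mul, a, b => (a * b) % 2 ^ w
  | .div, a, b => a / b
  | .mod, a, b => a % b

/-- The conditions that can be tested. -/
inductive Test where
  | eq (a b : Operand)
  | ne (a b : Operand)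
  | lt (a b : Operand)
  | le (a b : Operand)

/-- The condition holds in the state `s`. -/
def Test.Holds (w : ℕ) (s : State) : Test → Prop
  | .eq a b => a.val w s = b.val w s
  | .ne a b => a.val w s ≠ b.val w s
  | .lt a b => a.val w s < b.val w s
  | .le a b => a.val w s ≤ b.val w s

/-- Programs. -/
inductive Program where
  | skip
  /-- `x := a` -/
  | move (x : ℕ) (a : Operand)
  /-- `x := a o b` -/
  | arith (x : ℕ) (o : Op) (a b : Operand)
  /-- `x := A[i]` -/
  | load (x A : ℕ) (i : Operand)
  /-- `A[i] := a` -/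
  | store (A : ℕ) (i a : Operand)
  | seq (p q : Program)
  | ite (c : Test) (p q : Program)
  /-- `while c do p` -/
  | loop (c : Test) (p : Program)

/-- Write the word `a` into register `x`. -/
def State.setReg (s : State) (x a : ℕ) : State :=
  { s with reg := Function.update s.reg x a }

/-- Write the word `a` into cell `i` of array `A`. -/
def State.setArr (s : State) (A i a : ℕ) : State :=
  { s with arr := Function.update s.arr A (Function.update (s.arr A) i a) }

/-- `Run w p s t s'`: with word size `w`, the program `p` started in state `s` halts after exactly
`t` steps in state `s'`. -/
inductive Run (w : ℕ) : Program → State → ℕ → State → Prop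
  | skip (s : State) : Run w .skip s 1 s
  | move (s : State) (x : ℕ) (a : Operand) :
      Run w (.move x a) s 1 (s.setReg x (a.val w s))
  | arith (s : State) (x : ℕ) (o : Op) (a b : Operand) :
      Run w (.arith x o a b) s 1 (s.setReg x (o.eval w (a.val w s) (b.val w s)))
  | load (s : State) (x A : ℕ) (i : Operand) :
      Run w (.load x A i) s 1 (s.setReg x (s.arr A (i.val w s)))
  | store (s : State) (A : ℕ) (i a : Operand) :
      Run w (.store A i a) s 1 (s.setArr A (i.val w s) (a.val w s))
  | seq {p q : Program} {s s₁ s₂ : State} {t₁ t₂ : ℕ} :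
      Run w p s t₁ s₁ → Run w q s₁ t₂ s₂ → Run w (.seq p q) s (t₁ + t₂) s₂
  | iteTrue {c : Test} {p q : Program} {s s' : State} {t : ℕ} :
      c.Holds w s → Run w p s t s' → Run w (.ite c p q) s (t + 1) s'
  | iteFalse {c : Test} {p q : Program} {s s' : State} {t : ℕ} :
      ¬ c.Holds w s → Run w q s t s' → Run w (.ite c p q) s (t + 1) s'
  | loopStop {c : Test} {p : Program} {s : State} :
      ¬ c.Holds w s → Run w (.loop c p) s 1 s
  | loopStep {c : Test} {p : Program} {s s₁ s₂ : State} {t₁ t₂ : ℕ} :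
      c.Holds w s → Run w p s t₁ s₁ → Run w (.loop c p) s₁ t₂ s₂ →
      Run w (.loop c p) s (t₁ + t₂ + 1) s₂

/-- The machine is deterministic: the running time and the final state are determined by the
initial state. -/
theorem Run.deterministic {w : ℕ} {p : Program} {s s₁ : State} {t₁ : ℕ} (h₁ : Run w p s t₁ s₁) :
    ∀ {t₂ : ℕ} {s₂ : State}, Run w p s t₂ s₂ → t₁ = t₂ ∧ s₁ = s₂ := by
  induction h₁ with
  | skip | move | arith | load | store => intro _ _ h; cases h; exact ⟨rfl, rfl⟩
  | seq _ _ ih₁ ih₂ =>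
    intro _ _ h
    cases h with
    | seq a b =>
      obtain ⟨rfl, rfl⟩ := ih₁ a
      obtain ⟨rfl, rfl⟩ := ih₂ b
      exact ⟨rfl, rfl⟩
  | iteTrue hc _ ih =>
    intro _ _ h
    cases h with
    | iteTrue _ a => obtain ⟨rfl, rfl⟩ := ih a; exact ⟨rfl, rfl⟩
    | iteFalse hn _ => exact absurd hc hn
  | iteFalse hc _ ih =>
    intro _ _ h
    cases h with
    | iteTrue hn _ => exact absurd hn hc
    | iteFalse _ a => obtain ⟨rfl, rfl⟩ := ih a; exact ⟨rfl, rfl⟩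
  | loopStop hc =>
    intro _ _ h
    cases h with
    | loopStop _ => exact ⟨rfl, rfl⟩
    | loopStep hn _ _ => exact absurd hn hc
  | loopStep hc _ _ ih₁ ih₂ =>
    intro _ _ h
    cases h with
    | loopStop hn => exact absurd hc hn
    | loopStep _ a b =>
      obtain ⟨rfl, rfl⟩ := ih₁ a
      obtain ⟨rfl, rfl⟩ := ih₂ b
      exact ⟨rfl, rfl⟩

/-- The input: `n` and `m` in registers `0` and `1`, the endpoints of the `i`-th edge in cell `i` of
arrays `0` and `1`, its color in cell `i` of array `2`; everything else is `0`. -/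
def inputState {n m μ : ℕ} {G : SimpleGraph (Fin n)} (L : EdgeColoring.EdgeListing G m)
    (χ : EdgeColoring.PartialColoring G μ) : State where
  reg x := if x = 0 then n else if x = 1 then m else 0
  arr A i :=
    if h : i < m then
      if A = 0 then (L.fst ⟨i, h⟩ : ℕ)
      else if A = 1 then (L.snd ⟨i, h⟩ : ℕ)
      else if A = 2 then EdgeColoring.colorCode (χ (L.edge ⟨i, h⟩))
      else 0
    else 0

/-- The final state `s` holds the partial coloring `χ` in array `2`. -/
def Outputs {n m μ : ℕ} {G : SimpleGraph (Fin n)} (s : State) (L : EdgeColoring.EdgeListing G m)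
    (χ : EdgeColoring.PartialColoring G μ) : Prop :=
  ∀ i : Fin m, s.arr 2 i = EdgeColoring.colorCode (χ (L.edge i))

end WordRAM

/-! ### Total correctness with a time bound -/

namespace WordRAM

-- Extending to all uncolored edges asks only for a valid coloring of every edge with `Δ` colors,
-- where old colors may change. The program therefore discards the given colors and recolors the
-- bipartite graph from scratch, an algorithmic form of König's edge coloring theorem. It takes `O(m
-- log² m)` steps, which suffices because `2 ^ (c * √(log Δ)) ≥ 1`.
--
-- The basic tool is a balanced split. Pair the half-edges at each vertex, leaving at most one
-- single. The edges then form paths and cycles, the cycles are even by bipartiteness, and coloring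
-- alternately with two colors gives classes whose degrees differ by at most one at every vertex
-- (`Walk.step`, `Walk.next`, `Walk.isSplit`, `split_tr`). This takes `O(m)` steps.
--
-- Splits also give a matching that covers all vertices of maximum degree `D`. Take a power of two
-- `q > 2m` and give every edge the weight `⌊q / D⌋`. Each vertex then has total weight at most `q`,
-- and the total deficit at the vertices of degree `D` is below `q`. To halve `q`, halve the
-- weights, split the edges of odd weight, and round up on the side with more half-edges at the
-- vertices of degree `D`; both bounds survive (`Weights.init`, `Weights.halve`). At `q = 1` the
-- deficit is zero, and the edges of weight one are the matching (`Weights.matching`). This takes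
-- `O(m log m)` steps.
--
-- The coloring keeps `K` classes of maximum degree at most `D` and has used `o` colors, with `K * D
-- + o = Δ`. If `D` is odd, each class gives up a matching, at the price of one new color per class
-- (`Level.color_matching`). Then `D` is even, and a split replaces `K, D` by `2K, D / 2`
-- (`Level.split`). After about `log Δ` levels `D = 0`, and exactly `Δ` colors are available. The
-- classes live on disjoint copies of the vertex set, so one split or one matching treats them all
-- at once.

infixr:60 " ;; " => Program.seq

/-- The program `p`, started in `s`, halts within `b` steps in a state satisfying `Q`. -/
def Tr (w : ℕ) (p : Program) (s : State) (b : ℕ) (Q : State → Prop) : Prop :=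
  ∃ t s', Run w p s t s' ∧ t ≤ b ∧ Q s'

/-- `p` contains an instruction that writes register `x`. -/
def Program.writesReg (x : ℕ) : Program → Bool
  | .skip => false
  | .move y _ => x == y
  | .arith y _ _ _ => x == y
  | .load y _ _ => x == y
  | .store _ _ _ => false
  | .seq p q => p.writesReg x || q.writesReg x
  | .ite _ p q => p.writesReg x || q.writesReg x
  | .loop _ p => p.writesReg x

/-- `p` contains an instruction that writes array `A`. -/
def Program.writesArr (A : ℕ) : Program → Bool
  | .skip => false
  | .move _ _ => false
  | .arith _ _ _ _ => false
  | .load _ _ _ => false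
  | .store B _ _ => A == B
  | .seq p q => p.writesArr A || q.writesArr A
  | .ite _ p q => p.writesArr A || q.writesArr A
  | .loop _ p => p.writesArr A

/-- `s'` agrees with `s` on all registers and arrays that `p` does not write. -/
structure Frame (p : Program) (s s' : State) : Prop where
  reg : ∀ x, p.writesReg x = false → s'.reg x = s.reg x
  arr : ∀ A, p.writesArr A = false → s'.arr A = s.arr A

theorem Frame.refl (p : Program) (s : State) : Frame p s s := ⟨fun _ _ => rfl, fun _ _ => rfl⟩

theorem Frame.trans {p : Program} {s s₁ s₂ : State} (h : Frame p s s₁) (h' : Frame p s₁ s₂) :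
    Frame p s s₂ :=
  ⟨fun x hx => (h'.reg x hx).trans (h.reg x hx), fun A hA => (h'.arr A hA).trans (h.arr A hA)⟩

theorem Frame.of_sub {p q : Program} {s s' : State} (h : Frame p s s')
    (hr : ∀ x, q.writesReg x = false → p.writesReg x = false)
    (ha : ∀ A, q.writesArr A = false → p.writesArr A = false) : Frame q s s' :=
  ⟨fun x hx => h.reg x (hr x hx), fun A hA => h.arr A (ha A hA)⟩

@[simp] theorem State.setReg_reg (s : State) (x a y : ℕ) :
    (s.setReg x a).reg y = if y = x then a else s.reg y := by
  simp [State.setReg, Function.update_apply]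

@[simp] theorem State.setReg_arr (s : State) (x a : ℕ) : (s.setReg x a).arr = s.arr := rfl

@[simp] theorem State.setArr_reg (s : State) (A i a : ℕ) : (s.setArr A i a).reg = s.reg := rfl

@[simp] theorem State.setArr_arr (s : State) (A i a B : ℕ) :
    (s.setArr A i a).arr B = if B = A then Function.update (s.arr A) i a else s.arr B := by
  simp [State.setArr, Function.update_apply]

theorem Run.frame {w : ℕ} {p : Program} {s s' : State} {t : ℕ} (h : Run w p s t s') :
    Frame p s s' := by
  induction h with
  | skip => exact Frame.refl _ _
  | move | arith | load =>
    exact ⟨fun y hy => by simp_all [Program.writesReg], fun _ _ => rfl⟩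
  | store => exact ⟨fun _ _ => rfl, fun B hB => by simp_all [Program.writesArr]⟩
  | seq _ _ ih₁ ih₂ =>
    refine Frame.trans (ih₁.of_sub ?_ ?_) (ih₂.of_sub ?_ ?_) <;>
      simp +contextual [Program.writesReg, Program.writesArr]
  | iteTrue _ _ ih | iteFalse _ _ ih =>
    refine ih.of_sub ?_ ?_ <;> simp +contextual [Program.writesReg, Program.writesArr]
  | loopStop => exact Frame.refl _ _
  | loopStep _ _ _ ih₁ ih₂ => exact Frame.trans (ih₁.of_sub (fun _ h => h) (fun _ h => h)) ih₂

namespace Tr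

variable {w : ℕ} {p q : Program} {s : State} {b b' : ℕ} {Q Q' : State → Prop}

/-- The new postcondition may use the frame. Postconditions thus mention only what a program
computes, and the preservation of any other register or array follows by evaluating `writesReg` or
`writesArr`, hence by `rfl`. -/
theorem mono (h : Tr w p s b Q) (hb : b ≤ b') (hQ : ∀ s', Frame p s s' → Q s' → Q' s') :
    Tr w p s b' Q' := by
  obtain ⟨t, s', hr, ht, hq⟩ := h
  exact ⟨t, s', hr, ht.trans hb, hQ s' hr.frame hq⟩

theorem seq (h : Tr w p s b (fun s' => Frame p s s' → Tr w q s' b' Q)) :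
    Tr w (p ;; q) s (b + b') Q := by
  obtain ⟨t, s', hr, ht, t', s'', hr', ht', hq⟩ :=
    h.mono le_rfl (Q' := fun s' => Tr w q s' b' Q) (fun _ hf h => h hf)
  exact ⟨_, s'', hr.seq hr', by omega, hq⟩

theorem ite {c : Test} (h : c.Holds w s → Tr w p s b Q) (h' : ¬ c.Holds w s → Tr w q s b Q) :
    Tr w (.ite c p q) s (b + 1) Q := by
  by_cases hc : c.Holds w s
  · obtain ⟨t, s', hr, ht, hq⟩ := h hc
    exact ⟨_, s', .iteTrue hc hr, by omega, hq⟩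
  · obtain ⟨t, s', hr, ht, hq⟩ := h' hc
    exact ⟨_, s', .iteFalse hc hr, by omega, hq⟩

/-- A loop whose body takes at most `k` steps and decreases a potential `Φ`. -/
theorem loop {c : Test} {k : ℕ} (I : State → Prop) (Φ : State → ℕ) (h0 : I s)
    (step : ∀ s', Frame p s s' → I s' → c.Holds w s' →
      Tr w p s' k (fun s'' => I s'' ∧ Φ s'' < Φ s')) :
    Tr w (.loop c p) s ((k + 1) * Φ s + 1) (fun s' => I s' ∧ ¬ c.Holds w s') := by
  suffices H : ∀ n s', Φ s' = n → Frame p s s' → I s' →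
      Tr w (.loop c p) s' ((k + 1) * n + 1) (fun s' => I s' ∧ ¬ c.Holds w s') from
    H _ s rfl (Frame.refl _ _) h0
  intro n
  induction n using Nat.strong_induction_on with
  | _ n ih =>
    intro s' hn hf hI
    by_cases hc : c.Holds w s'
    · obtain ⟨t, s₁, hr, ht, hI₁, hlt⟩ := step s' hf hI hc
      obtain ⟨t₂, s₂, hr₂, ht₂, hq⟩ := ih (Φ s₁) (hn ▸ hlt) s₁ rfl (hf.trans hr.frame) hI₁
      refine ⟨_, s₂, .loopStep hc hr hr₂, ?_, hq⟩
      have : (k + 1) * (Φ s₁ + 1) ≤ (k + 1) * n := Nat.mul_le_mul_left _ (by omega)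
      rw [Nat.mul_add] at this
      omega
    · exact ⟨1, s', .loopStop hc, by omega, hI, hc⟩

end Tr

/-! ### Weakest preconditions of programs without loops -/

/-- The value of an operand, if its literal fits into a word. -/
def Operand.ev (s : State) : Operand → ℕ
  | .reg x => s.reg x
  | .lit k => k

/-- The literal, if any, is at most `3`. -/
def Operand.small : Operand → Bool
  | .reg _ => true
  | .lit k => k ≤ 3

theorem Operand.val_eq {w : ℕ} (hw : 3 < 2 ^ w) {s : State} {a : Operand} (ha : a.small = true) :
    a.val w s = a.ev s := by
  cases a with
  | reg x => rfl
  | lit k =>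
    simp only [small, decide_eq_true_eq] at ha
    exact Nat.mod_eq_of_lt (by omega)

def Test.small : Test → Bool
  | .eq a b | .ne a b | .lt a b | .le a b => a.small && b.small

/-- The condition holds, if its literals fit into a word. -/
def Test.Ev (s : State) : Test → Prop
  | .eq a b => a.ev s = b.ev s
  | .ne a b => a.ev s ≠ b.ev s
  | .lt a b => a.ev s < b.ev s
  | .le a b => a.ev s ≤ b.ev s

theorem Test.holds_iff {w : ℕ} (hw : 3 < 2 ^ w) {s : State} {c : Test} (hc : c.small = true) :
    c.Holds w s ↔ c.Ev s := by
  cases c <;> simp only [small, Bool.and_eq_true] at hc <;>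
    simp [Holds, Ev, Operand.val_eq hw hc.1, Operand.val_eq hw hc.2]

/-- The operation does not overflow. -/
def Op.Fits (w : ℕ) : Op → ℕ → ℕ → Prop
  | .add, a, b => a + b < 2 ^ w
  | .mul, a, b => a * b < 2 ^ w
  | _, _, _ => True

/-- The result of an operation that does not overflow. -/
def Op.ev : Op → ℕ → ℕ → ℕ
  | .add, a, b => a + b
  | .sub, a, b => a - b
  | .mul, a, b => a * b
  | .div, a, b => a / b
  | .mod, a, b => a % b

theorem Op.eval_eq {w : ℕ} {o : Op} {a b : ℕ} (h : o.Fits w a b) : o.eval w a b = o.ev a b := by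
  cases o <;> first | rfl | exact Nat.mod_eq_of_lt h

/-- The program has no loops, and all its literals are at most `3`. -/
def Program.simple : Program → Bool
  | .skip => true
  | .move _ a => a.small
  | .arith _ _ a b => a.small && b.small
  | .load _ _ i => i.small
  | .store _ i a => i.small && a.small
  | .seq p q => p.simple && q.simple
  | .ite c p q => c.small && p.simple && q.simple
  | .loop _ _ => false

/-- A bound on the number of steps of a program without loops. -/
def Program.cost : Program → ℕ
  | .seq p q => p.cost + q.cost
  | .ite _ p q => max p.cost q.cost + 1
  | _ => 1

/-- The weakest precondition of a program without loops, including the absence of overflows. -/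
def Program.wp (w : ℕ) : Program → (State → Prop) → State → Prop
  | .skip, Q, s => Q s
  | .move x a, Q, s => Q (s.setReg x (a.ev s))
  | .arith x o a b, Q, s =>
    o.Fits w (a.ev s) (b.ev s) ∧ Q (s.setReg x (o.ev (a.ev s) (b.ev s)))
  | .load x A i, Q, s => Q (s.setReg x (s.arr A (i.ev s)))
  | .store A i a, Q, s => Q (s.setArr A (i.ev s) (a.ev s))
  | .seq p q, Q, s => p.wp w (fun s' => q.wp w Q s') s
  | .ite c p q, Q, s => (c.Ev s → p.wp w Q s) ∧ (¬ c.Ev s → q.wp w Q s)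
  | .loop _ _, _, _ => False

attribute [simp] Operand.ev Test.Ev Op.Fits Op.ev Program.wp

/-- The overflow conditions inside `wp` and the smallness of the literals let arithmetic modulo `2 ^
w` be replaced by arithmetic in `ℕ`. Straight-line code is then verified by `simp` and `omega`. -/
theorem Tr.of_wp_cost {w : ℕ} (hw : 3 < 2 ^ w) {p : Program} (hp : p.simple = true) {s : State}
    {Q : State → Prop} (h : p.wp w Q s) : Tr w p s p.cost Q := by
  induction p generalizing s Q with
  | skip => exact ⟨1, s, .skip s, le_rfl, h⟩
  | move x a =>
    refine ⟨1, _, .move s x a, le_rfl, ?_⟩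
    rw [Operand.val_eq hw hp]; exact h
  | arith x o a b =>
    simp only [Program.simple, Bool.and_eq_true] at hp
    refine ⟨1, _, .arith s x o a b, le_rfl, ?_⟩
    rw [Operand.val_eq hw hp.1, Operand.val_eq hw hp.2, Op.eval_eq h.1]; exact h.2
  | load x A i =>
    refine ⟨1, _, .load s x A i, le_rfl, ?_⟩
    rw [Operand.val_eq hw hp]; exact h
  | store A i a =>
    simp only [Program.simple, Bool.and_eq_true] at hp
    refine ⟨1, _, .store s A i a, le_rfl, ?_⟩
    rw [Operand.val_eq hw hp.1, Operand.val_eq hw hp.2]; exact h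
  | seq p q ihp ihq =>
    simp only [Program.simple, Bool.and_eq_true] at hp
    exact Tr.seq ((ihp hp.1 h).mono le_rfl (fun s' _ h' _ => ihq hp.2 h'))
  | ite c p q ihp ihq =>
    simp only [Program.simple, Bool.and_eq_true] at hp
    have hc := Test.holds_iff hw (s := s) hp.1.1
    exact Tr.ite
      (fun hh => (ihp hp.1.2 (h.1 (hc.1 hh))).mono (le_max_left _ _) (fun _ _ h => h))
      (fun hh => (ihq hp.2 (h.2 (fun he => hh (hc.2 he)))).mono (le_max_right _ _) (fun _ _ h => h))
  | loop => exact h.elim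

theorem Tr.of_wp {w : ℕ} (hw : 3 < 2 ^ w) {p : Program} (hp : p.simple = true) {k : ℕ}
    (hk : p.cost ≤ k) {s : State} {Q : State → Prop} (h : p.wp w Q s) : Tr w p s k Q :=
  (Tr.of_wp_cost hw hp h).mono hk (fun _ _ h => h)

/-- `for r = 0, …, N - 1 do p`, where `r` and `N` are registers. -/
def Program.forUpTo (r N : ℕ) (p : Program) : Program :=
  .move r (.lit 0) ;; .loop (.lt (.reg r) (.reg N)) (p ;; .arith r .add (.reg r) (.lit 1))

/-- Each round costs the body, the increment and the test, hence `k + 2`. The invariant is required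
after the counter has been written, because the increment comes after the body. -/
theorem Tr.forUpTo {w : ℕ} (hw : 3 < 2 ^ w) {r N : ℕ} {p : Program} {s : State} {k : ℕ}
    (I : ℕ → State → Prop) (hr : p.writesReg r = false) (hN : p.writesReg N = false)
    (hrN : N ≠ r) (hfit : s.reg N < 2 ^ w) (h0 : I 0 (s.setReg r 0))
    (step : ∀ i s', i < s.reg N → Frame (.forUpTo r N p) s s' → s'.reg r = i → I i s' →
      Tr w p s' k (fun s'' => I (i + 1) (s''.setReg r (i + 1)))) :
    Tr w (.forUpTo r N p) s ((k + 2) * s.reg N + 2) (I (s.reg N)) := by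
  have hmove : Tr w (.move r (.lit 0)) s 1 (fun s' => s' = s.setReg r 0) :=
    ⟨1, _, .move s r _, le_rfl, by simp [Operand.val]⟩
  have hb : (k + 2) * s.reg N + 2 = 1 + ((k + 1 + 1) * (s.reg N) + 1) := by ring
  rw [hb]
  refine Tr.seq (hmove.mono le_rfl ?_)
  rintro s₁ - rfl -
  refine (Tr.loop (s := s.setReg r 0) (k := k + 1)
    (fun s' => s'.reg r ≤ s.reg N ∧ s'.reg N = s.reg N ∧ I (s'.reg r) s')
    (fun s' => s.reg N - s'.reg r) ?_ ?_).mono ?_ ?_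
  · simpa [hrN] using h0
  · rintro s' hf ⟨hle, hNe, hI⟩ hc
    simp only [Test.Holds, Operand.val, hNe] at hc
    have hfr : Frame (.forUpTo r N p) s s' := by
      refine Frame.trans (s₁ := s.setReg r 0) ⟨fun x hx => ?_, fun _ _ => rfl⟩ (hf.of_sub ?_ ?_)
      · simp_all [Program.forUpTo, Program.writesReg]
      · simp +contextual [Program.forUpTo, Program.writesReg]
      · simp +contextual [Program.forUpTo, Program.writesArr]
    refine Tr.seq ((step _ s' hc hfr rfl hI).mono le_rfl ?_)
    intro s'' hf'' hI'' _
    have e1 : s''.reg r = s'.reg r := hf''.reg r hr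
    have e2 : s''.reg N = s'.reg N := hf''.reg N hN
    have h1 : 1 % 2 ^ w = 1 := Nat.mod_eq_of_lt (by omega)
    have h2 : (s'.reg r + 1) % 2 ^ w = s'.reg r + 1 := Nat.mod_eq_of_lt (by omega)
    refine ⟨1, _, .arith _ _ _ _ _, le_rfl, ?_⟩
    simp only [Operand.val, Op.eval, h1, e1, h2, State.setReg_reg, if_true, hrN, if_false, e2, hNe]
    exact ⟨⟨by omega, trivial, hI''⟩, by omega⟩
  · simp
  · rintro s' - ⟨⟨hle, hNe, hI⟩, hc⟩
    simp only [Test.Holds, Operand.val, hNe] at hc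
    have : s'.reg r = s.reg N := by omega
    rwa [this] at hI

end WordRAM

/-! ### Balanced splits

The edges are numbered `0, …, m - 1`, and edge `i` has the half-edges `2 * i` and `2 * i + 1`. The
half-edge `h` is attached to the vertex `E h`. A set of edges is given by its indicator `F`. -/

namespace BalancedSplit

/-- The other half of the same edge. -/
def twin (h : ℕ) : ℕ := h + 1 - 2 * (h % 2)

/-- `p` pairs off the first `k` half-edges of `F` that share a vertex (`p h = g + 1` if `h` is
paired with `g`, and `p h = 0` if `h` is single); `S x` is the single half-edge at `x`, plus `1`. -/
structure PartialPairing (E F : ℕ → ℕ) (k : ℕ) (p S : ℕ → ℕ) : Prop where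
  paired : ∀ h < k, p h ≠ 0 →
    F (h / 2) = 1 ∧ p h - 1 < k ∧ p (p h - 1) = h + 1 ∧ E (p h - 1) = E h ∧ p h ≠ h + 1
  slot : ∀ x, S x ≠ 0 → S x - 1 < k ∧ E (S x - 1) = x ∧ p (S x - 1) = 0 ∧ F ((S x - 1) / 2) = 1
  single : ∀ h < k, F (h / 2) = 1 → p h = 0 → S (E h) = h + 1

/-- `p` pairs off the half-edges of `F` at each vertex, up to at most one. -/
structure Pairing (E F : ℕ → ℕ) (k : ℕ) (p : ℕ → ℕ) : Prop where
  paired : ∀ h < k, p h ≠ 0 →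
    F (h / 2) = 1 ∧ p h - 1 < k ∧ p (p h - 1) = h + 1 ∧ E (p h - 1) = E h ∧ p h ≠ h + 1
  unique : ∀ h < k, ∀ g < k, F (h / 2) = 1 → F (g / 2) = 1 → p h = 0 → p g = 0 → E h = E g → h = g

variable {E F p S : ℕ → ℕ} {k : ℕ}

theorem PartialPairing.zero (hS : ∀ x, S x = 0) : PartialPairing E F 0 p S :=
  ⟨by simp, by simp [hS], by simp⟩

theorem PartialPairing.pairing (h : PartialPairing E F k p S) : Pairing E F k p :=
  ⟨h.paired, fun a ha b hb fa fb pa pb e => by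
    have h1 := h.single a ha fa pa
    have h2 := h.single b hb fb pb
    rw [e] at h1; omega⟩

theorem PartialPairing.skip (h : PartialPairing E F k p S) (hF : F (k / 2) ≠ 1) :
    PartialPairing E F (k + 1) (Function.update p k 0) S := by
  obtain ⟨h1, h2, h3⟩ := h
  refine ⟨fun g hg hne => ?_, fun x hx => ?_, fun g hg hFg hg0 => ?_⟩
  · have e : g ≠ k := by rintro rfl; simp at hne
    rw [Function.update_of_ne e] at hne ⊢
    obtain ⟨a1, a2, a3, a4, a5⟩ := h1 g (by omega) hne
    rw [Function.update_of_ne (by omega)]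
    exact ⟨a1, by omega, a3, a4, a5⟩
  · obtain ⟨a1, a2, a3, a4⟩ := h2 x hx
    rw [Function.update_of_ne (by omega)]
    exact ⟨by omega, a2, a3, a4⟩
  · have e : g ≠ k := by rintro rfl; exact hF hFg
    rw [Function.update_of_ne e] at hg0
    exact h3 g (by omega) hFg hg0

theorem PartialPairing.open_slot (h : PartialPairing E F k p S) (hF : F (k / 2) = 1)
    (hS : S (E k) = 0) :
    PartialPairing E F (k + 1) (Function.update p k 0) (Function.update S (E k) (k + 1)) := by
  obtain ⟨h1, h2, h3⟩ := h
  refine ⟨fun g hg hne => ?_, fun x hx => ?_, fun g hg hFg hg0 => ?_⟩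
  · have e : g ≠ k := by rintro rfl; simp at hne
    rw [Function.update_of_ne e] at hne ⊢
    obtain ⟨a1, a2, a3, a4, a5⟩ := h1 g (by omega) hne
    rw [Function.update_of_ne (by omega)]
    exact ⟨a1, by omega, a3, a4, a5⟩
  · rcases eq_or_ne x (E k) with rfl | e
    · simp [hF]
    · rw [Function.update_of_ne e] at hx ⊢
      obtain ⟨a1, a2, a3, a4⟩ := h2 x hx
      rw [Function.update_of_ne (by omega)]
      exact ⟨by omega, a2, a3, a4⟩
  · rcases eq_or_ne g k with rfl | e
    · simp
    · rw [Function.update_of_ne e] at hg0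
      have h4 := h3 g (by omega) hFg hg0
      rw [Function.update_of_ne (by intro h5; rw [h5] at h4; omega)]
      exact h4

/-- The half-edge `k` finds another one waiting at its vertex. The two become partners and the slot
is emptied, so at most one half-edge per vertex ever waits. -/
theorem PartialPairing.close_slot (h : PartialPairing E F k p S) (hF : F (k / 2) = 1)
    (hS : S (E k) ≠ 0) :
    PartialPairing E F (k + 1)
      (Function.update (Function.update p k (S (E k))) (S (E k) - 1) (k + 1))
      (Function.update S (E k) 0) := by
  obtain ⟨h1, h2, h3⟩ := h
  obtain ⟨b1, b2, b3, b4⟩ := h2 (E k) hS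
  set z := S (E k) - 1 with hz
  have hzS : S (E k) = z + 1 := by omega
  rw [hzS]
  refine ⟨fun g hg hne => ?_, fun x hx => ?_, fun g hg hFg hg0 => ?_⟩
  · rcases eq_or_ne g z with rfl | e
    · have e : k ≠ z := by omega
      simp only [Function.update_self, Nat.add_sub_cancel, Function.update_of_ne e]
      exact ⟨b4, by omega, trivial, b2.symm, by omega⟩
    · rw [Function.update_of_ne e] at hne ⊢
      rcases eq_or_ne g k with rfl | e'
      · simp only [Function.update_self, Nat.add_sub_cancel]
        exact ⟨hF, by omega, trivial, b2, by omega⟩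
      · rw [Function.update_of_ne e'] at hne ⊢
        obtain ⟨a1, a2, a3, a4, a5⟩ := h1 g (by omega) hne
        rw [Function.update_of_ne (by intro h; rw [h] at a3; omega),
          Function.update_of_ne (by omega)]
        exact ⟨a1, by omega, a3, a4, a5⟩
  · have e : x ≠ E k := by rintro rfl; simp at hx
    rw [Function.update_of_ne e] at hx ⊢
    obtain ⟨a1, a2, a3, a4⟩ := h2 x hx
    -- A half-edge waits only at its own vertex, so `z` is in no other slot.
    have : S x - 1 ≠ z := by intro h; rw [h] at a2; exact e (a2.symm.trans b2)
    rw [Function.update_of_ne this, Function.update_of_ne (by omega)]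
    exact ⟨by omega, a2, a3, a4⟩
  · have e : g ≠ z := by rintro rfl; simp at hg0
    rw [Function.update_of_ne e] at hg0
    have e' : g ≠ k := by rintro rfl; simp at hg0
    rw [Function.update_of_ne e'] at hg0
    have h4 := h3 g (by omega) hFg hg0
    rw [Function.update_of_ne (by intro h5; rw [h5] at h4; omega)]
    exact h4

/-- The number of half-edges at the vertex `x` with color `c`. -/
def colorCount (E : ℕ → ℕ) (m : ℕ) (col : ℕ → ℕ) (c x : ℕ) : ℕ :=
  ((Finset.range (2 * m)).filter (fun h => E h = x ∧ col (h / 2) = c)).card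

/-- `col` splits the edges of `F` into those of color `1` and those of color `2`, evenly at each
vertex. -/
structure IsSplit (E F : ℕ → ℕ) (m : ℕ) (col : ℕ → ℕ) : Prop where
  mem : ∀ i < m, F i = 1 → col i = 1 ∨ col i = 2
  not_mem : ∀ i < m, F i ≠ 1 → col i = 0
  one_le : ∀ x, colorCount E m col 1 x ≤ colorCount E m col 2 x + 1
  two_le : ∀ x, colorCount E m col 2 x ≤ colorCount E m col 1 x + 1

/-- The state of the coloring procedure: the alternating walk that started at the half-edge `b` has
reached the half-edge `h`. -/
structure Walk (E F : ℕ → ℕ) (m : ℕ) (p : ℕ → ℕ) (b h : ℕ) (col : ℕ → ℕ) : Prop where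
  mem : ∀ i < m, col i ≠ 0 → F i = 1 ∧ (col i = 1 ∨ col i = 2)
  ne : ∀ g < 2 * m, p g ≠ 0 → col (g / 2) ≠ 0 → col ((p g - 1) / 2) ≠ 0 →
    col (g / 2) ≠ col ((p g - 1) / 2)
  -- The partially colored trail has at most two open ends: the current one, and the far half of the
  -- starting edge. The latter exists only for even `b`, since for odd `b` the edge was entered at
  -- `b - 1` and is now followed the other way.
  frontier : ∀ g < 2 * m, p g ≠ 0 → col (g / 2) ≠ 0 → col ((p g - 1) / 2) = 0 →
    g = h ∨ g = twin b ∧ b % 2 = 0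
  done : ∀ g < 2 * m, g ≤ b → F (g / 2) = 1 → col (g / 2) ≠ 0
  lt : b < 2 * m → h < 2 * m
  base_le : b ≤ 2 * m
  idle : F (b / 2) ≠ 1 → h = b
  -- Color and side of the bipartition change together at every step; this is what makes closed
  -- walks even.
  parity : ∀ β : ℕ → Bool, (∀ i < m, F i = 1 → β (E (2 * i)) ≠ β (E (2 * i + 1))) →
    b < 2 * m → F (b / 2) = 1 → col (h / 2) ≠ 0 ∧
      (col (h / 2) = col (b / 2) ↔ β (E h) = β (E b))

variable {m b h : ℕ} {col : ℕ → ℕ}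

theorem twin_div (h : ℕ) : twin h / 2 = h / 2 := by unfold twin; omega

theorem twin_ne (h : ℕ) : twin h ≠ h := by unfold twin; omega

theorem twin_lt (hh : h < 2 * m) : twin h < 2 * m := by unfold twin; omega

theorem bool_twin {β : ℕ → Bool} (hβ : ∀ i < m, F i = 1 → β (E (2 * i)) ≠ β (E (2 * i + 1)))
    {g : ℕ} (hg : g < 2 * m) (hF : F (g / 2) = 1) : β (E (twin g)) ≠ β (E g) := by
  have := hβ (g / 2) (by omega) hF
  rcases Nat.mod_two_eq_zero_or_one g with h0 | h0
  · have e1 : 2 * (g / 2) = g := by omega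
    have e2 : twin g = g + 1 := by unfold twin; omega
    rw [e1] at this; rw [e2]; exact this.symm
  · have e1 : 2 * (g / 2) + 1 = g := by omega
    have e2 : twin g = 2 * (g / 2) := by unfold twin; omega
    rw [e1] at this; rw [e2]; exact this

/-- The walk goes on through the half-edge paired with `h`. -/
theorem Walk.step (hp : Pairing E F (2 * m) p) (hw : Walk E F m p b h col)
    (hE : ∃ β : ℕ → Bool, ∀ i < m, F i = 1 → β (E (2 * i)) ≠ β (E (2 * i + 1)))
    (hb : b < 2 * m) (hF : F (b / 2) = 1)
    (h1 : p h ≠ 0) (h2 : col ((p h - 1) / 2) = 0) :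
    Walk E F m p b (twin (p h - 1))
      (Function.update col ((p h - 1) / 2) (3 - col (h / 2))) := by
  obtain ⟨hmem, hne, hfr, hdone, hlt, hble, hidle, hpar⟩ := hw
  have hh := hlt hb
  obtain ⟨q1, q2, q3, q4, q5⟩ := hp.paired h hh h1
  set g := p h - 1 with hg
  obtain ⟨r1, -⟩ := hp.paired g q2 (by omega)
  obtain ⟨β, hβ⟩ := hE
  obtain ⟨c0, c1⟩ := hpar β hβ hb hF
  have c2 := (hmem (h / 2) (by omega) c0).2
  have hbc := hdone b hb le_rfl hF
  have hbc' := (hmem (b / 2) (by omega) hbc).2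
  have tg := twin_lt q2
  have td := twin_div g
  have tn := twin_ne g
  have tb := bool_twin hβ q2 r1
  have same : ∀ a, a / 2 = g / 2 → a = g ∨ a = twin g := by intro a; unfold twin; omega
  have hhg : h / 2 ≠ g / 2 := by intro e; rw [e] at c0; exact c0 h2
  -- The case of a closing cycle: if the far end of the new edge meets a colored half-edge,
  -- `frontier` forces it to be `twin b`. By `parity` the starting edge then has the color of `h /
  -- 2`, opposite to the new color.
  have key : ∀ a < 2 * m, p a = twin g + 1 → col (a / 2) ≠ 0 →
      col (a / 2) = col (h / 2) := by
    intro a ha hpa hca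
    obtain ⟨a1, a2, a3, a4, a5⟩ := hp.paired a ha (by omega)
    have hpa' : p a - 1 = twin g := by omega
    rw [hpa'] at a3 a4
    rcases hfr a ha (by omega) hca (by rw [hpa', td]; exact h2) with rfl | ⟨rfl, hb2⟩
    · exfalso; omega
    · have t1 := bool_twin hβ hb hF
      rw [twin_div] at hca ⊢
      by_contra hcc
      have h3 : ¬ (β (E h) = β (E b)) := fun e => hcc (c1.2 e).symm
      rw [a4] at tb; rw [q4] at tb
      revert tb t1 h3
      cases β (E (twin b)) <;> cases β (E h) <;> cases β (E b) <;> simp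
  refine ⟨?_, ?_, ?_, ?_, fun _ => tg, hble, fun h => absurd hF h, ?_⟩
  · intro i hi
    simp only [Function.update_apply]
    split_ifs with hig
    · subst hig; intro _; exact ⟨r1, by omega⟩
    · exact hmem i hi
  · intro a ha hpa
    obtain ⟨a1, a2, a3, a4, a5⟩ := hp.paired a ha hpa
    simp only [Function.update_apply]
    by_cases e1 : a / 2 = g / 2
    · rcases same a e1 with rfl | rfl
      · rw [q3]; simp [hhg]; omega
      · by_cases e2 : (p (twin g) - 1) / 2 = g / 2
        · exfalso
          rcases same _ e2 with e3 | e3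
          · rw [e3, q3] at a3
            have : twin g = h := by omega
            exact hhg (by rw [← this, td])
          · omega
        · intro _ h5
          simp only [e1, e2, if_true, if_false] at h5 ⊢
          rw [key _ a2 (by omega) h5]; omega
    · by_cases e2 : (p a - 1) / 2 = g / 2
      · intro h5 _
        simp only [e1, e2, if_true, if_false] at h5 ⊢
        rcases same _ e2 with e3 | e3
        · rw [e3, q3] at a3
          have : a = h := by omega
          subst this; omega
        · rw [key a ha (by omega) h5]; omega
      · simp only [e1, e2, if_false]; exact hne a ha hpa
  · intro a ha hpa
    simp only [Function.update_apply]
    by_cases e2 : (p a - 1) / 2 = g / 2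
    · simp only [e2, if_true]; intro _ h5; omega
    · by_cases e1 : a / 2 = g / 2
      · rcases same a e1 with rfl | rfl
        · rw [q3, Nat.add_sub_cancel, if_neg hhg]; intro _ h5; exact absurd h5 c0
        · intros; exact Or.inl rfl
      · simp only [e1, e2, if_false]
        intro h5 h6
        rcases hfr a ha hpa h5 h6 with rfl | h7
        · exact absurd rfl e2
        · exact Or.inr h7
  · intro a ha hab hFa
    simp only [Function.update_apply]
    split_ifs
    · omega
    · exact hdone a ha hab hFa
  · intro β' hβ' _ _
    obtain ⟨d0, d1⟩ := hpar β' hβ' hb hF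
    have tb' := bool_twin hβ' q2 r1
    have e1 : b / 2 ≠ g / 2 := by intro e; rw [e] at hbc; exact hbc h2
    simp only [Function.update_apply, td, e1, if_true, if_false]
    refine ⟨by omega, ?_⟩
    rw [q4] at tb'
    have e5 : 3 - col (h / 2) = col (b / 2) ↔ ¬ (col (h / 2) = col (b / 2)) := by omega
    rw [e5, d1]
    revert tb'
    cases β' (E h) <;> cases β' (E b) <;> cases β' (E (twin g)) <;> simp

/-- Paired half-edges share a vertex, whereas the two halves of an edge lie on opposite sides. -/
theorem Pairing.edge_ne (hp : Pairing E F (2 * m) p)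
    (hE : ∃ β : ℕ → Bool, ∀ i < m, F i = 1 → β (E (2 * i)) ≠ β (E (2 * i + 1)))
    {g : ℕ} (hg : g < 2 * m) (h0 : p g ≠ 0) : (p g - 1) / 2 ≠ g / 2 := by
  obtain ⟨a1, a2, a3, a4, a5⟩ := hp.paired g hg h0
  obtain ⟨β, hβ⟩ := hE
  have h1 := bool_twin hβ hg a1
  intro e
  have : p g - 1 = twin g := by unfold twin; omega
  rw [← this, a4] at h1
  exact h1 rfl

/-- A new walk begins at the half-edge `b + 1`. -/
theorem Walk.next (hp : Pairing E F (2 * m) p) (hw : Walk E F m p b h col)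
    (hE : ∃ β : ℕ → Bool, ∀ i < m, F i = 1 → β (E (2 * i)) ≠ β (E (2 * i + 1)))
    (hb : b < 2 * m) (hend : p h = 0 ∨ col ((p h - 1) / 2) ≠ 0) :
    Walk E F m p (b + 1) (b + 1) (if F ((b + 1) / 2) = 1 ∧ col ((b + 1) / 2) = 0 then
      Function.update col ((b + 1) / 2) 1 else col) := by
  have hself := fun a ha hpa => hp.edge_ne hE (g := a) ha hpa
  obtain ⟨hmem, hne, hfr, hdone, hlt, hble, hidle, hpar⟩ := hw
  -- The walk is stuck at `h`, so the only possible open end is `twin b = b + 1` with `b` even,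
  -- where the next walk begins.
  have hfr' : ∀ g < 2 * m, p g ≠ 0 → col (g / 2) ≠ 0 → col ((p g - 1) / 2) = 0 →
      g = b + 1 ∧ b % 2 = 0 := by
    intro g hg h1 h2 h3
    rcases hfr g hg h1 h2 h3 with rfl | ⟨rfl, h4⟩
    · tauto
    · exact ⟨by unfold twin; omega, h4⟩
  split_ifs with hc
  · obtain ⟨hc1, hc2⟩ := hc
    -- For even `b` the half-edge `b + 1` belongs to the edge of `b`, which is already colored by
    -- `done`.
    have hodd : b + 1 < 2 * m → b % 2 = 1 := by
      intro hlt'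
      by_contra h0
      refine hdone b hb le_rfl ?_ ?_ <;> rw [show b / 2 = (b + 1) / 2 by omega] <;> assumption
    have hfr'' : ∀ g < 2 * m, p g ≠ 0 → col (g / 2) ≠ 0 → col ((p g - 1) / 2) = 0 → False := by
      intro g hg h1 h2 h3
      obtain ⟨rfl, h4⟩ := hfr' g hg h1 h2 h3
      exact h2 hc2
    refine ⟨?_, ?_, ?_, ?_, fun h => h, by omega, fun _ => rfl, ?_⟩
    · intro i hi
      simp only [Function.update_apply]
      split_ifs with hig
      · subst hig; intro _; exact ⟨hc1, by omega⟩
      · exact hmem i hi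
    · intro a ha hpa
      obtain ⟨a1, a2, a3, a4, a5⟩ := hp.paired a ha hpa
      simp only [Function.update_apply]
      have h1 := hne a ha hpa
      have h2 := hfr'' a ha hpa
      have h3 := hfr'' _ a2 (by omega)
      rw [a3] at h3
      split_ifs with e1 e2 e2
      · exact absurd (e2.trans e1.symm) (hself a ha hpa)
      · rw [show a + 1 - 1 = a from rfl, e1] at h3
        intro _ h5; exact absurd (h3 h5 hc2) id
      · rw [e2] at h2
        intro h5 _; exact absurd (h2 h5 hc2) id
      · exact h1
    · intro a ha hpa
      have h2 := hfr'' a ha hpa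
      simp only [Function.update_apply]
      split_ifs with e1 e2 e2
      · intro _ h; exact h.elim
      · intro _ _
        by_cases hbm : b + 1 < 2 * m
        · have := hodd hbm
          unfold twin; omega
        · omega
      · intro _ h; exact h.elim
      · intro h3 h4; exact absurd (h2 h3 h4) id
    · intro a ha hab hFa
      simp only [Function.update_apply]
      split_ifs with e
      · omega
      · refine hdone a ha ?_ hFa
        by_contra h0
        exact e (by rw [show a = b + 1 by omega])
    · intro β hβ _ _
      simp
  · refine ⟨hmem, hne, ?_, ?_, fun h => h, by omega, fun _ => rfl, ?_⟩
    · intro g hg h1 h2 h3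
      exact Or.inl (hfr' g hg h1 h2 h3).1
    · intro a ha hab hFa
      rcases Nat.lt_or_ge b a with h0 | h0
      · rw [show a = b + 1 by omega] at hFa ⊢; tauto
      · exact hdone a ha h0 hFa
    · intro β hβ hb1 hF1
      simp; tauto

theorem Walk.init (hp : Pairing E F (2 * m) p) (h0 : ∀ i < m, col i = 0)
    (hE : ∃ β : ℕ → Bool, ∀ i < m, F i = 1 → β (E (2 * i)) ≠ β (E (2 * i + 1))) :
    Walk E F m p 0 0 (if F 0 = 1 then Function.update col 0 1 else col) := by
  have hself := fun a ha hpa => hp.edge_ne hE (g := a) ha hpa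
  have hz : ∀ g < 2 * m, g / 2 ≠ 0 →
      (if F 0 = 1 then Function.update col 0 1 else col) (g / 2) = 0 := by
    intro g hg h
    split_ifs
    · rw [Function.update_of_ne h]; exact h0 _ (by omega)
    · exact h0 _ (by omega)
  refine ⟨?_, ?_, ?_, ?_, fun h => h, by omega, fun _ => rfl, ?_⟩
  · intro i hi
    split_ifs with hF
    · simp only [Function.update_apply]
      split_ifs with e
      · subst e; simp [hF]
      · exact fun h => absurd (h0 i hi) h
    · exact fun h => absurd (h0 i hi) h
  · intro g hg hpg h1 h2
    obtain ⟨-, a2, -⟩ := hp.paired g hg hpg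
    have e1 : g / 2 = 0 := by by_contra h; exact h1 (hz g hg h)
    have e2 : (p g - 1) / 2 = 0 := by by_contra h; exact h2 (hz _ a2 h)
    exact absurd (e2.trans e1.symm) (hself g hg hpg)
  · intro g hg hpg h1 h2
    have e1 : g / 2 = 0 := by by_contra h; exact h1 (hz g hg h)
    unfold twin; omega
  · intro g hg hg0 hF
    have e1 : g / 2 = 0 := by omega
    rw [e1] at hF ⊢
    simp [hF]
  · intro β hβ h1 h2
    have h2 : F 0 = 1 := h2
    simp [h2]

/-- Partners have opposite colors, so the pairing injects the paired half-edges of color `c` at `x`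
into those of color `c'`. At most one half-edge at `x` is single. -/
theorem Walk.colorCount_le (hp : Pairing E F (2 * m) p) (hw : Walk E F m p (2 * m) h col)
    {c c' : ℕ} (hc : c = 1 ∧ c' = 2 ∨ c = 2 ∧ c' = 1) (x : ℕ) :
    colorCount E m col c x ≤ colorCount E m col c' x + 1 := by
  unfold colorCount
  set A := (Finset.range (2 * m)).filter (fun h => E h = x ∧ col (h / 2) = c) with hA
  have hAm : ∀ g ∈ A, g < 2 * m ∧ E g = x ∧ col (g / 2) = c ∧ F (g / 2) = 1 := by
    intro g hg
    simp only [hA, Finset.mem_filter, Finset.mem_range] at hg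
    exact ⟨hg.1, hg.2.1, hg.2.2, (hw.mem (g / 2) (by omega) (by omega)).1⟩
  rw [← Finset.card_filter_add_card_filter_not (s := A) (fun g => p g ≠ 0)]
  refine Nat.add_le_add ?_ ?_
  · refine Finset.card_le_card_of_injOn (fun g => p g - 1) ?_ ?_
    · intro g hg
      simp only [Finset.coe_filter, Set.mem_ofPred_eq] at hg
      obtain ⟨g1, g2, g3, g4⟩ := hAm g hg.1
      obtain ⟨a1, a2, a3, a4, a5⟩ := hp.paired g g1 hg.2
      obtain ⟨b1, -⟩ := hp.paired _ a2 (by omega)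
      have h1 := hw.done _ a2 (by omega) b1
      have h2 := hw.ne g g1 hg.2 (by omega) h1
      have h3 := (hw.mem ((p g - 1) / 2) (by omega) h1).2
      simp only [Finset.coe_filter, Finset.mem_range, Set.mem_ofPred_eq]
      exact ⟨a2, by rw [a4, g2], by omega⟩
    · intro g hg g' hg' he
      simp only [Finset.coe_filter, Set.mem_ofPred_eq] at hg hg' he
      obtain ⟨-, -, a3, -⟩ := hp.paired g (hAm g hg.1).1 hg.2
      obtain ⟨-, -, b3, -⟩ := hp.paired g' (hAm g' hg'.1).1 hg'.2
      rw [he] at a3; omega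
  · rw [Finset.card_le_one]
    intro g hg g' hg'
    simp only [Finset.mem_filter, not_not] at hg hg'
    obtain ⟨g1, g2, g3, g4⟩ := hAm g hg.1
    obtain ⟨f1, f2, f3, f4⟩ := hAm g' hg'.1
    exact hp.unique g g1 g' f1 g4 f4 hg.2 hg'.2 (by rw [g2, f2])

theorem Walk.isSplit (hp : Pairing E F (2 * m) p) (hw : Walk E F m p (2 * m) h col) :
    IsSplit E F m col := by
  refine ⟨fun i hi hF => ?_, fun i hi hF => ?_, fun x => hw.colorCount_le hp (by simp) x,
    fun x => hw.colorCount_le hp (by simp) x⟩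
  · have h1 := hw.done (2 * i) (by omega) (by omega)
    rw [show 2 * i / 2 = i by omega] at h1
    exact (hw.mem i hi (h1 hF)).2
  · by_contra h1
    exact hF (hw.mem i hi h1).1

end BalancedSplit

/-! ### A program for balanced splits

Register `1` holds the number `m` of edges and register `2` holds `2 * m`. Array `3` holds the
vertices of the half-edges, and array `4` the indicator of the set of edges to be split. The colors
of the split are written to array `7`. Array `5` (the slots at the vertices) is kept equal to `0`
between calls, and array `6` holds the pairing. -/

namespace WordRAM

open BalancedSplit

/-- Pair the half-edge in register `10` with the half-edge waiting at its vertex, or let it wait. -/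
def pairBody : Program :=
  .arith 13 .div (.reg 10) (.lit 2) ;;
  .load 14 4 (.reg 13) ;;
  .store 6 (.reg 10) (.lit 0) ;;
  .store 7 (.reg 13) (.lit 0) ;;
  .ite (.eq (.reg 14) (.lit 1))
    (.load 15 3 (.reg 10) ;;
      .load 16 5 (.reg 15) ;;
      .arith 17 .add (.reg 10) (.lit 1) ;;
      .ite (.eq (.reg 16) (.lit 0))
        (.store 5 (.reg 15) (.reg 17))
        (.arith 18 .sub (.reg 16) (.lit 1) ;;
          .store 6 (.reg 10) (.reg 16) ;;
          .store 6 (.reg 18) (.reg 17) ;;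
          .store 5 (.reg 15) (.lit 0)))
    .skip

/-- Set `A[v]` to `0` for every vertex `v` of a half-edge. -/
def clearVertices (A : ℕ) : Program :=
  .forUpTo 10 2 (.load 13 3 (.reg 10) ;; .store A (.reg 13) (.lit 0))

/-- Start the first walk. -/
def walkInit : Program :=
  .move 11 (.lit 0) ;;
  .move 12 (.lit 0) ;;
  .load 13 4 (.lit 0) ;;
  .ite (.eq (.reg 13) (.lit 1)) (.store 7 (.lit 0) (.lit 1)) .skip

/-- Continue the walk from the half-edge in register `12` through the paired half-edge; if that is
not possible, start a walk at the next half-edge after the one in register `11`. -/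
def walkBody : Program :=
  .load 13 6 (.reg 12) ;;
  .arith 14 .sub (.reg 13) (.lit 1) ;;
  .arith 15 .div (.reg 14) (.lit 2) ;;
  .load 16 7 (.reg 15) ;;
  .ite (.eq (.reg 13) (.lit 0)) (.move 16 (.lit 1)) .skip ;;
  .ite (.eq (.reg 16) (.lit 0))
    (.arith 17 .div (.reg 12) (.lit 2) ;;
      .load 18 7 (.reg 17) ;;
      .arith 18 .sub (.lit 3) (.reg 18) ;;
      .store 7 (.reg 15) (.reg 18) ;;
      .arith 19 .mod (.reg 14) (.lit 2) ;;
      .arith 19 .mul (.lit 2) (.reg 19) ;;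
      .arith 12 .add (.reg 14) (.lit 1) ;;
      .arith 12 .sub (.reg 12) (.reg 19))
    (.arith 11 .add (.reg 11) (.lit 1) ;;
      .move 12 (.reg 11) ;;
      .arith 17 .div (.reg 11) (.lit 2) ;;
      .load 18 4 (.reg 17) ;;
      .load 19 7 (.reg 17) ;;
      .ite (.eq (.reg 18) (.lit 1))
        (.ite (.eq (.reg 19) (.lit 0)) (.store 7 (.reg 17) (.lit 1)) .skip)
        .skip)

/-- Split the set of edges in array `4` evenly at each vertex. -/
def split : Program :=
  .forUpTo 10 2 pairBody ;;
  clearVertices 5 ;;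
  walkInit ;;
  .loop (.lt (.reg 11) (.reg 2)) walkBody

variable {w m : ℕ} {s : State}

/-- Only cells at vertices of half-edges can be nonzero, so the cost depends on `m` and not on the
range of the vertex numbers. -/
theorem clearVertices_tr (A : ℕ) (hA : A ≠ 3) (hw : 4 * m + 4 < 2 ^ w) (h2 : s.reg 2 = 2 * m)
    (hs : ∀ x, s.arr A x ≠ 0 → ∃ h < 2 * m, s.arr 3 h = x) :
    Tr w (clearVertices A) s (8 * m + 2) (fun s' => ∀ x, s'.arr A x = 0) := by
  refine Tr.mono (Tr.forUpTo (k := 2) (by omega) (fun k s' => ∀ x, s'.arr A x ≠ 0 →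
    ∃ h < 2 * m, k ≤ h ∧ s.arr 3 h = x) rfl rfl (by simp) (by omega) ?_ ?_) ?_ ?_
  · simpa using hs
  · intro i s' hi hF hr hI
    have e3 : s'.arr 3 = s.arr 3 := hF.arr 3 (by
      simpa [Program.forUpTo, Program.writesArr] using fun h => hA h.symm)
    refine Tr.of_wp (by omega) rfl le_rfl ?_
    simp only [Program.wp, Operand.ev, State.setReg_reg, State.setReg_arr,
      State.setArr_arr, if_true, hr, e3, Function.update_apply]
    intro x hx
    split_ifs at hx with hxe
    · exact absurd rfl hx
    · obtain ⟨h, a1, a2, a3⟩ := hI x hx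
      refine ⟨h, a1, ?_, a3⟩
      rcases Nat.lt_or_ge i h with h5 | h5
      · exact h5
      · rw [show h = i by omega] at a3
        exact absurd a3.symm hxe
  · rw [h2]; omega
  · intro s' _ h x
    by_contra hx
    obtain ⟨h, a1, a2, a3⟩ := h x hx
    omega

theorem pair_tr (hw : 4 * m + 4 < 2 ^ w) (h2 : s.reg 2 = 2 * m) (hs : ∀ x, s.arr 5 x = 0) :
    Tr w (.forUpTo 10 2 pairBody) s (44 * (m + 1)) (fun s' =>
      PartialPairing (s.arr 3) (s.arr 4) (2 * m) (s'.arr 6) (s'.arr 5) ∧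
      ∀ i < m, s'.arr 7 i = 0) := by
  refine Tr.mono (Tr.forUpTo (k := 20) (by omega) (fun k s' =>
    PartialPairing (s.arr 3) (s.arr 4) k (s'.arr 6) (s'.arr 5) ∧ ∀ h < k, s'.arr 7 (h / 2) = 0)
    rfl rfl (by simp) (by omega) ?_ ?_) ?_ ?_
  · exact ⟨.zero hs, by simp⟩
  · rintro i s' hi hF hr ⟨hI, hI'⟩
    have e3 : s'.arr 3 = s.arr 3 := hF.arr 3 rfl
    have e4 : s'.arr 4 = s.arr 4 := hF.arr 4 rfl
    rw [h2] at hi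
    have h7 : ∀ h < i + 1, Function.update (s'.arr 7) (i / 2) 0 (h / 2) = 0 := by
      intro h hh
      rw [Function.update_apply]
      split_ifs with e
      · rfl
      · exact hI' h (by by_contra h5; exact e (by rw [show h = i by omega]))
    refine Tr.of_wp (by omega) rfl (by decide) ?_
    simp [pairBody, hr, e3, e4]
    refine ⟨fun h1 => ⟨by omega, fun h0 => ⟨hI.open_slot h1 h0, fun h hh => h7 h (by omega)⟩,
      fun h0 => ⟨hI.close_slot h1 h0, fun h hh => h7 h (by omega)⟩⟩, fun h1 => ⟨hI.skip h1, fun h hh => h7 h (by omega)⟩⟩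
  · rw [h2]; omega
  · rintro s' _ ⟨h, h'⟩
    rw [h2] at h h'
    refine ⟨h, fun i hi => ?_⟩
    have := h' (2 * i) (by omega)
    rwa [show 2 * i / 2 = i by omega] at this

/-- The number of edges of `F` without a color. -/
def uncoloredCount (F : ℕ → ℕ) (m : ℕ) (col : ℕ → ℕ) : ℕ :=
  ((Finset.range m).filter (fun i => F i = 1 ∧ col i = 0)).card

theorem uncoloredCount_le (F : ℕ → ℕ) (m : ℕ) (col : ℕ → ℕ) : uncoloredCount F m col ≤ m :=
  (Finset.card_filter_le _ _).trans (by simp)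

theorem uncoloredCount_update_le (F : ℕ → ℕ) (m : ℕ) (col : ℕ → ℕ) (i : ℕ) {a : ℕ} (ha : a ≠ 0) :
    uncoloredCount F m (Function.update col i a) ≤ uncoloredCount F m col := by
  refine Finset.card_le_card fun j => ?_
  simp only [Finset.mem_filter, Function.update_apply]
  split_ifs <;> simp_all

theorem uncoloredCount_update_lt {F : ℕ → ℕ} {m : ℕ} {col : ℕ → ℕ} {i a : ℕ} (ha : a ≠ 0)
    (hi : i < m) (hF : F i = 1) (hc : col i = 0) :
    uncoloredCount F m (Function.update col i a) < uncoloredCount F m col := by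
  refine Finset.card_lt_card (Finset.ssubset_iff_subset_ne.2 ⟨fun j => ?_, fun h => ?_⟩)
  · simp only [Finset.mem_filter, Function.update_apply]
    split_ifs <;> simp_all
  · have : i ∈ (Finset.range m).filter (fun i => F i = 1 ∧ col i = 0) := by simp [*]
    rw [← h] at this
    simp [ha] at this

theorem walk_tr (hw : 4 * m + 4 < 2 ^ w) (h2 : s.reg 2 = 2 * m)
    (hp : Pairing (s.arr 3) (s.arr 4) (2 * m) (s.arr 6))
    (hE : ∃ β : ℕ → Bool, ∀ i < m, s.arr 4 i = 1 →
      β (s.arr 3 (2 * i)) ≠ β (s.arr 3 (2 * i + 1)))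
    (h0 : Walk (s.arr 3) (s.arr 4) m (s.arr 6) (s.reg 11) (s.reg 12) (s.arr 7)) :
    Tr w (.loop (.lt (.reg 11) (.reg 2)) walkBody) s (60 * (m + 1)) (fun s' =>
      IsSplit (s.arr 3) (s.arr 4) m (s'.arr 7)) := by
  refine Tr.mono (Tr.loop (k := 18) (fun s' =>
    Walk (s.arr 3) (s.arr 4) m (s.arr 6) (s'.reg 11) (s'.reg 12) (s'.arr 7))
    -- Every round either colors an edge or advances the base of the walk, so the potential drops
    -- from at most `3 * m`.
    (fun s' => 2 * m - s'.reg 11 + uncoloredCount (s.arr 4) m (s'.arr 7)) h0 ?_) ?_ ?_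
  · intro s' hF hI hc
    have e2 : s'.reg 2 = 2 * m := (hF.reg 2 rfl).trans h2
    have e3 : s'.arr 3 = s.arr 3 := hF.arr 3 rfl
    have e4 : s'.arr 4 = s.arr 4 := hF.arr 4 rfl
    have e6 : s'.arr 6 = s.arr 6 := hF.arr 6 rfl
    simp only [Test.Holds, Operand.val, e2] at hc
    obtain ⟨b, hbr⟩ : ∃ b, s'.reg 11 = b := ⟨_, rfl⟩
    obtain ⟨h, hhr⟩ : ∃ h, s'.reg 12 = h := ⟨_, rfl⟩
    rw [hbr] at hc
    rw [hbr, hhr] at hI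
    have hh := hI.lt hc
    have hnext := fun hend => hI.next hp hE hc hend
    have hstep := fun hb => hI.step hp hE hc hb
    have hpair := hp.paired h hh
    have hmem := hI.mem (h / 2) (by omega)
    have hpar := hI.parity
    refine Tr.of_wp (by omega) rfl (by decide) ?_
    have tw : ∀ g, g + 1 - 2 * (g % 2) = twin g := fun _ => rfl
    have hdrop : 2 * m - (b + 1) < 2 * m - b := by omega
    by_cases hgo : s.arr 6 h ≠ 0 ∧ s'.arr 7 ((s.arr 6 h - 1) / 2) = 0
    · obtain ⟨g0, g1⟩ := hgo
      obtain ⟨a1, a2, a3, a4, a5⟩ := hpair g0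
      have hb : s.arr 4 (b / 2) = 1 := by
        by_contra hb
        have := hI.idle hb
        rw [show h = b from this] at a1
        exact hb a1
      obtain ⟨β, hβ⟩ := hE
      have hc0 := (hpar β hβ hc hb).1
      have hc1 := (hmem hc0).2
      obtain ⟨r1, -⟩ := hp.paired _ a2 (by omega)
      have hlt := uncoloredCount_update_lt (col := s'.arr 7) (a := 3 - s'.arr 7 (h / 2))
        (by omega) (show (s.arr 6 h - 1) / 2 < m by omega) r1 g1
      simp [walkBody, e6, hbr, hhr, g0, g1, tw]
      exact ⟨by omega, by omega, hstep hb g0 g1, hlt⟩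
    · have hend : s.arr 6 h = 0 ∨ s'.arr 7 ((s.arr 6 h - 1) / 2) ≠ 0 := by tauto
      have hn := hnext hend
      have hu := uncoloredCount_update_le (s.arr 4) m (s'.arr 7) ((b + 1) / 2) one_ne_zero
      simp [walkBody, e4, e6, hbr, hhr]
      refine ⟨fun _ => ⟨by omega, ?_⟩,
        fun h1 => ⟨fun h2 => absurd ⟨h1, h2⟩ hgo, fun _ => ⟨by omega, ?_⟩⟩⟩
      all_goals
        refine ⟨fun h1 => ⟨fun h2 => ?_, fun h2 => ?_⟩, fun h1 => ?_⟩
        · rw [if_pos ⟨h1, h2⟩] at hn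
          exact ⟨hn, by omega⟩
        · simp only [h2, and_false, if_false] at hn
          exact ⟨hn, hdrop⟩
        · simp only [h1, false_and, if_false] at hn
          exact ⟨hn, hdrop⟩
  · have := uncoloredCount_le (s.arr 4) m (s.arr 7)
    have : 19 * (2 * m - s.reg 11 + uncoloredCount (s.arr 4) m (s.arr 7)) ≤ 19 * (3 * m) :=
      Nat.mul_le_mul_left _ (by omega)
    omega
  · rintro s' hF ⟨h, hc⟩
    have e2 : s'.reg 2 = 2 * m := (hF.reg 2 rfl).trans h2
    simp only [Test.Holds, Operand.val, e2, not_lt] at hc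
    have := h.base_le
    rw [show s'.reg 11 = 2 * m by omega] at h
    exact h.isSplit hp

theorem split_tr (hw : 4 * m + 4 < 2 ^ w) (h2 : s.reg 2 = 2 * m) (hs : ∀ x, s.arr 5 x = 0)
    (hE : ∃ β : ℕ → Bool, ∀ i < m, s.arr 4 i = 1 →
      β (s.arr 3 (2 * i)) ≠ β (s.arr 3 (2 * i + 1))) :
    Tr w split s (120 * (m + 1)) (fun s' =>
      IsSplit (s.arr 3) (s.arr 4) m (s'.arr 7) ∧ ∀ x, s'.arr 5 x = 0) := by
  rw [split]
  refine Tr.mono (Tr.seq ((pair_tr hw h2 hs).mono le_rfl ?_)) ?_ (fun _ _ h => h)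
    (b := 44 * (m + 1) + ((8 * m + 2) + (6 + 60 * (m + 1))))
  · rintro s₁ - ⟨hp, hz⟩ hF₁
    have e2 : s₁.reg 2 = 2 * m := (hF₁.reg 2 rfl).trans h2
    have e3 : s₁.arr 3 = s.arr 3 := hF₁.arr 3 rfl
    have e4 : s₁.arr 4 = s.arr 4 := hF₁.arr 4 rfl
    have hslot : ∀ x, s₁.arr 5 x ≠ 0 → ∃ h < 2 * m, s₁.arr 3 h = x := fun x hx => by
      obtain ⟨a1, a2, -⟩ := hp.slot x hx
      exact ⟨_, a1, by rw [e3]; exact a2⟩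
    refine Tr.seq ((clearVertices_tr 5 (by decide) hw e2 hslot).mono le_rfl ?_)
    intro s₂ _ hs₂ hF₂
    have e2 : s₂.reg 2 = 2 * m := (hF₂.reg 2 rfl).trans e2
    have e3 : s₂.arr 3 = s.arr 3 := (hF₂.arr 3 rfl).trans e3
    have e4 : s₂.arr 4 = s.arr 4 := (hF₂.arr 4 rfl).trans e4
    have e6 : s₂.arr 6 = s₁.arr 6 := hF₂.arr 6 rfl
    have e7 : s₂.arr 7 = s₁.arr 7 := hF₂.arr 7 rfl
    refine Tr.seq (Tr.mono (Tr.of_wp (p := walkInit) (by omega) rfl (by decide) (k := 6) (Q := fun s₃ =>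
      Walk (s.arr 3) (s.arr 4) m (s₁.arr 6) (s₃.reg 11) (s₃.reg 12) (s₃.arr 7)) ?_) ?_ ?_)
    · have := Walk.init hp.pairing hz hE
      simp [walkInit, e4, e7]
      constructor <;> intro h <;> simpa [h] using this
    · exact le_rfl
    · intro s₃ _ hW hF₃
      have e2 : s₃.reg 2 = 2 * m := (hF₃.reg 2 rfl).trans e2
      have e3 : s₃.arr 3 = s.arr 3 := (hF₃.arr 3 rfl).trans e3
      have e4 : s₃.arr 4 = s.arr 4 := (hF₃.arr 4 rfl).trans e4
      have e5 : s₃.arr 5 = s₂.arr 5 := hF₃.arr 5 rfl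
      have e6 : s₃.arr 6 = s₁.arr 6 := (hF₃.arr 6 rfl).trans e6
      refine Tr.mono (walk_tr hw e2 (by rw [e3, e4, e6]; exact hp.pairing) (by rwa [e3, e4])
        (by rwa [e3, e4, e6])) le_rfl ?_
      intro s₄ hF₄ h
      rw [e3, e4] at h
      exact ⟨h, by rw [hF₄.arr 5 rfl, e5]; exact hs₂⟩
  · omega

end WordRAM

/-! ### Matchings from repeated balanced splits

An edge `i < m` is active if `a i = 0`; the degree of the vertex `x` in the graph of the active edges
is `colorCount E m a 0 x`. -/

namespace BalancedSplit

variable {E a F col wt wt' : ℕ → ℕ} {m D q : ℕ}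

/-- The half-edges at the vertices of degree `D`. -/
def topHalves (E a : ℕ → ℕ) (m D : ℕ) : Finset ℕ :=
  (Finset.range (2 * m)).filter (fun h => colorCount E m a 0 (E h) = D)

/-- The half-edges at the vertex `x`. -/
def halvesAt (E : ℕ → ℕ) (m x : ℕ) : Finset ℕ :=
  (Finset.range (2 * m)).filter (fun h => E h = x)

/-- Edge weights of total at most `q` at each vertex, and with a total deficit less than `q` at the
vertices of degree `D`. -/
structure Weights (E a : ℕ → ℕ) (m D q : ℕ) (wt : ℕ → ℕ) : Prop where
  support : ∀ i < m, wt i ≠ 0 → a i = 0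
  le : ∀ x, ∑ h ∈ halvesAt E m x, wt (h / 2) ≤ q
  top : q * ((topHalves E a m D).image E).card < q + ∑ h ∈ topHalves E a m D, wt (h / 2)

/-- A weight is twice its half plus its parity, and the edges of odd weight are exactly those of
color `1` or `2`. -/
theorem IsSplit.sum_eq (hs : IsSplit E F m col) (hF : ∀ i < m, F i = wt i % 2) {S : Finset ℕ}
    (hS : S ⊆ Finset.range (2 * m)) :
    ∑ h ∈ S, wt (h / 2) = 2 * ∑ h ∈ S, wt (h / 2) / 2 +
      (S.filter (fun h => col (h / 2) = 1)).card + (S.filter (fun h => col (h / 2) = 2)).card := by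
  rw [Finset.card_filter, Finset.card_filter, Finset.mul_sum, ← Finset.sum_add_distrib,
    ← Finset.sum_add_distrib]
  refine Finset.sum_congr rfl fun h hh => ?_
  have hi : h / 2 < m := by have := Finset.mem_range.1 (hS hh); omega
  have h1 := hF _ hi
  have h2 := hs.mem _ hi
  have h3 := hs.not_mem _ hi
  split_ifs <;> omega

theorem sum_half_eq {c : ℕ} (hw : ∀ i < m, wt' i = wt i / 2 + if col i = c then 1 else 0)
    {S : Finset ℕ} (hS : S ⊆ Finset.range (2 * m)) :
    ∑ h ∈ S, wt' (h / 2) =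
      ∑ h ∈ S, wt (h / 2) / 2 + (S.filter (fun h => col (h / 2) = c)).card := by
  rw [Finset.card_filter, ← Finset.sum_add_distrib]
  refine Finset.sum_congr rfl fun h hh => hw _ ?_
  have := Finset.mem_range.1 (hS hh)
  omega

theorem colorCount_eq (E : ℕ → ℕ) (m : ℕ) (col : ℕ → ℕ) (c x : ℕ) :
    colorCount E m col c x = ((halvesAt E m x).filter (fun h => col (h / 2) = c)).card := by
  rw [colorCount, halvesAt, Finset.filter_filter]

/-- Halving the weights, with the odd ones rounded up on the side of the split that has more
half-edges at the vertices of degree `D`. -/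
theorem Weights.halve (hW : Weights E a m D (2 * q) wt) (hF : ∀ i < m, F i = wt i % 2)
    (hs : IsSplit E F m col) {c c' : ℕ} (hc : c = 1 ∧ c' = 2 ∨ c = 2 ∧ c' = 1)
    (hle : ((topHalves E a m D).filter (fun h => col (h / 2) = c')).card ≤
      ((topHalves E a m D).filter (fun h => col (h / 2) = c)).card)
    (hw : ∀ i < m, wt' i = wt i / 2 + if col i = c then 1 else 0) :
    Weights E a m D q wt' := by
  refine ⟨fun i hi h => ?_, fun x => ?_, ?_⟩
  · refine hW.support i hi fun h0 => h ?_
    have h3 := hs.not_mem i hi (by rw [hF i hi, h0]; decide)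
    rw [hw i hi, h0, h3, if_neg (by omega)]
  -- With `S` the sum of the halved weights and `n₁`, `n₂` the color counts, `2 * S + n₁ + n₂ ≤ 2 *
  -- q`. The counts differ by at most one, so integrality gives `S + n₁ ≤ q` and `S + n₂ ≤ q`.
  · have h1 := hs.sum_eq hF (S := halvesAt E m x) (Finset.filter_subset _ _)
    have h2 := sum_half_eq hw (S := halvesAt E m x) (Finset.filter_subset _ _)
    have h3 := hs.one_le x
    have h4 := hs.two_le x
    have h5 := hW.le x
    rw [colorCount_eq, colorCount_eq] at h3 h4
    rcases hc with ⟨rfl, rfl⟩ | ⟨rfl, rfl⟩ <;> omega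
  -- By the choice of `c`, the new total over the top half-edges is at least half the old one, so
  -- the deficit is at least halved.
  · have h1 := hs.sum_eq hF (S := topHalves E a m D) (Finset.filter_subset _ _)
    have h2 := sum_half_eq hw (S := topHalves E a m D) (Finset.filter_subset _ _)
    have h5 := hW.top
    rw [Nat.mul_assoc] at h5
    rcases hc with ⟨rfl, rfl⟩ | ⟨rfl, rfl⟩ <;> omega

theorem sum_topHalves (E a : ℕ → ℕ) (m D : ℕ) (wt : ℕ → ℕ) :
    ∑ h ∈ topHalves E a m D, wt (h / 2) =
      ∑ x ∈ (topHalves E a m D).image E, ∑ h ∈ halvesAt E m x, wt (h / 2) := by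
  rw [← Finset.sum_fiberwise_of_maps_to (g := E) (t := (topHalves E a m D).image E)
    (fun h hh => Finset.mem_image_of_mem E hh)]
  refine Finset.sum_congr rfl fun x hx => Finset.sum_congr ?_ fun _ _ => rfl
  obtain ⟨g, hg, rfl⟩ := Finset.mem_image.1 hx
  have hg' := (Finset.mem_filter.1 hg).2
  ext h
  simp only [topHalves, halvesAt, Finset.mem_filter]
  constructor
  · rintro ⟨⟨h1, h2⟩, h3⟩; exact ⟨h1, h3⟩
  · rintro ⟨h1, h3⟩; exact ⟨⟨h1, by rw [h3]; exact hg'⟩, h3⟩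

theorem sum_active (E a : ℕ → ℕ) (m α x : ℕ) :
    ∑ h ∈ halvesAt E m x, (if a (h / 2) = 0 then α else 0) = colorCount E m a 0 x * α := by
  rw [colorCount_eq, ← Finset.sum_filter, Finset.sum_const, smul_eq_mul]

/-- The initial weights. -/
theorem Weights.init (hD : 0 < D) (hdeg : ∀ x, colorCount E m a 0 x ≤ D) (hq : 2 * m < q)
    (hw : ∀ i < m, wt i = if a i = 0 then q / D else 0) : Weights E a m D q wt := by
  have hsum : ∀ x, ∑ h ∈ halvesAt E m x, wt (h / 2) = colorCount E m a 0 x * (q / D) := by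
    intro x
    rw [← sum_active]
    refine Finset.sum_congr rfl fun h hh => hw _ ?_
    have := Finset.mem_range.1 (Finset.filter_subset _ _ hh)
    omega
  have hqD : D * (q / D) ≤ q := Nat.mul_div_le q D
  refine ⟨fun i hi h => ?_, fun x => ?_, ?_⟩
  · by_contra h0
    rw [hw i hi, if_neg h0] at h
    exact h rfl
  · rw [hsum]
    exact (Nat.mul_le_mul_right _ (hdeg x)).trans hqD
  · have htop : ∀ x ∈ (topHalves E a m D).image E, colorCount E m a 0 x = D := by
      intro x hx
      obtain ⟨g, hg, rfl⟩ := Finset.mem_image.1 hx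
      exact (Finset.mem_filter.1 hg).2
    set X := (topHalves E a m D).image E
    -- Each top vertex lacks `q % D < D`, so the total deficit is at most `X.card * D`, which counts
    -- half-edges and is thus at most `2 * m < q`.
    have hXD : X.card * D ≤ 2 * m := by
      have h1 : ∑ x ∈ X, colorCount E m a 0 x = X.card * D := by
        rw [Finset.sum_congr rfl htop, Finset.sum_const, smul_eq_mul]
      rw [← h1]
      have h2 : ∑ x ∈ X, colorCount E m a 0 x ≤ ∑ x ∈ X, (halvesAt E m x).card := by
        refine Finset.sum_le_sum fun x _ => ?_
        rw [colorCount_eq]; exact Finset.card_filter_le _ _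
      refine h2.trans ?_
      have h3 := sum_topHalves E a m D (fun _ => 1)
      simp only [Finset.sum_const, smul_eq_mul, mul_one] at h3
      rw [← h3]
      exact (Finset.card_filter_le _ _).trans (by simp)
    rw [sum_topHalves, Finset.sum_congr rfl (fun x hx => (hsum x).trans (by rw [htop x hx])),
      Finset.sum_const, smul_eq_mul]
    change q * X.card < q + X.card * (D * (q / D))
    have hmod := Nat.div_add_mod q D
    have hlt := Nat.mod_lt q hD
    have h4 : q * X.card = X.card * (D * (q / D)) + X.card * (q % D) := by
      rw [← Nat.mul_add, hmod, Nat.mul_comm]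
    have h5 : X.card * (q % D) ≤ X.card * D := Nat.mul_le_mul_left _ hlt.le
    omega

/-- The edges of weight `1` form a matching that covers all vertices of degree `D`. -/
structure Matching (E a : ℕ → ℕ) (m D : ℕ) (wt : ℕ → ℕ) : Prop where
  active : ∀ i < m, wt i = 1 → a i = 0
  disjoint : ∀ h < 2 * m, ∀ g < 2 * m, wt (h / 2) = 1 → wt (g / 2) = 1 → E h = E g → h = g
  covers : ∀ x, colorCount E m a 0 x = D → ∃ h < 2 * m, E h = x ∧ wt (h / 2) = 1

theorem Weights.apply_le (hW : Weights E a m D q wt) {i : ℕ} (hi : i < m) : wt i ≤ q := by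
  have h1 := hW.le (E (2 * i))
  have h2 := Finset.single_le_sum (f := fun h => wt (h / 2)) (s := halvesAt E m (E (2 * i)))
    (fun _ _ => Nat.zero_le _) (a := 2 * i) (by simp [halvesAt]; omega)
  simp only [show 2 * i / 2 = i by omega] at h2
  omega

/-- A deficit below `1` is zero, while an uncovered vertex of degree `D` would contribute a deficit
of one that no other vertex compensates. -/
theorem Weights.matching (hW : Weights E a m D 1 wt) (hD : 0 < D) : Matching E a m D wt := by
  refine ⟨fun i hi h => hW.support i hi (by omega), fun h hh g hg w1 w2 he => ?_, fun x hx => ?_⟩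
  · by_contra hne
    have h1 := hW.le (E h)
    have h2 : ∑ k ∈ ({h, g} : Finset ℕ), wt (k / 2) ≤ ∑ k ∈ halvesAt E m (E h), wt (k / 2) := by
      refine Finset.sum_le_sum_of_subset fun k hk => ?_
      simp only [Finset.mem_insert, Finset.mem_singleton] at hk
      rcases hk with rfl | rfl <;> simp [halvesAt, *]
    rw [Finset.sum_pair hne] at h2
    omega
  · have hmem : x ∈ (topHalves E a m D).image E := by
      have h1 : 0 < colorCount E m a 0 x := by omega
      obtain ⟨h, hh⟩ := Finset.card_pos.1 h1
      simp only [Finset.mem_filter] at hh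
      refine Finset.mem_image.2 ⟨h, ?_, hh.2.1⟩
      simp only [topHalves, Finset.mem_filter]
      exact ⟨hh.1, by rw [hh.2.1]; exact hx⟩
    by_contra hno
    push Not at hno
    have h0 : ∑ h ∈ halvesAt E m x, wt (h / 2) = 0 := by
      refine Finset.sum_eq_zero fun h hh => ?_
      simp only [halvesAt, Finset.mem_filter, Finset.mem_range] at hh
      have h1 := hno h hh.1 hh.2
      have h2 := hW.apply_le (show h / 2 < m by omega)
      omega
    have h1 := hW.top
    rw [sum_topHalves, ← Finset.add_sum_erase _ _ hmem, h0] at h1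
    have h2 := Finset.sum_le_card_nsmul (((topHalves E a m D).image E).erase x)
      (fun x => ∑ h ∈ halvesAt E m x, wt (h / 2)) 1 (fun y _ => hW.le y)
    rw [Finset.card_erase_of_mem hmem, smul_eq_mul, mul_one] at h2
    have h3 : 0 < ((topHalves E a m D).image E).card := Finset.card_pos.2 ⟨x, hmem⟩
    omega

/-- Removing the edges of the matching decreases the maximum degree. -/
theorem Matching.colorCount_lt (hM : Matching E a m D wt) (hdeg : ∀ x, colorCount E m a 0 x ≤ D)
    {a' : ℕ → ℕ} (ha : ∀ i < m, wt i = 1 → a' i ≠ 0)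
    (ha' : ∀ i < m, wt i ≠ 1 → a' i = a i) (x : ℕ) : colorCount E m a' 0 x < D := by
  have hsub : (Finset.range (2 * m)).filter (fun h => E h = x ∧ a' (h / 2) = 0) ⊆
      (Finset.range (2 * m)).filter (fun h => E h = x ∧ a (h / 2) = 0) := by
    intro h hh
    simp only [Finset.mem_filter, Finset.mem_range] at hh ⊢
    have hi : h / 2 < m := by omega
    refine ⟨hh.1, hh.2.1, ?_⟩
    rw [← ha' _ hi (fun h1 => ha _ hi h1 hh.2.2)]
    exact hh.2.2
  rcases (hdeg x).lt_or_eq with hlt | heq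
  · exact (Finset.card_le_card hsub).trans_lt hlt
  · rw [← heq]
    obtain ⟨h, h1, h2, h3⟩ := hM.covers x heq
    have hi : h / 2 < m := by omega
    refine Finset.card_lt_card ((Finset.ssubset_iff_of_subset hsub).2 ⟨h, ?_, ?_⟩)
    · simp [h1, h2, hM.active _ hi h3]
    · simp [ha _ hi h3]

end BalancedSplit

/-! ### A program for matchings

Array `2` holds the colors of the edges (`0` for the active ones), array `8` the degrees (kept equal
to `0` between calls) and array `9` the weights. Register `3` holds the degree bound `D`, and
register `6` a power of `2` above `2 * m`. -/

namespace WordRAM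

open BalancedSplit

variable {w m : ℕ} {s : State}

/-- A loop that sets `A[i] = f i` for all `i` below the bound. -/
theorem Tr.fill (hw : 3 < 2 ^ w) {r N : ℕ} {p : Program} {k : ℕ} (A : ℕ) (f : ℕ → ℕ)
    (hr : p.writesReg r = false) (hN : p.writesReg N = false) (hrN : N ≠ r)
    (hfit : s.reg N < 2 ^ w)
    (step : ∀ i s', i < s.reg N → Frame (.forUpTo r N p) s s' → s'.reg r = i →
      s'.arr A i = s.arr A i →
      Tr w p s' k (fun s'' => s''.arr A = Function.update (s'.arr A) i (f i))) :
    Tr w (.forUpTo r N p) s ((k + 2) * s.reg N + 2) (fun s' => ∀ i < s.reg N, s'.arr A i = f i) := by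
  refine Tr.mono (Tr.forUpTo hw (fun k s' => ∀ i, s'.arr A i = if i < k then f i else s.arr A i)
    hr hN hrN hfit (by simp) ?_) le_rfl (fun s' _ h i hi => by rw [h i, if_pos hi])
  intro i s' hi hF hri hI
  refine (step i s' hi hF hri (by simp [hI])).mono le_rfl ?_
  intro s'' _ h j
  simp only [State.setReg_arr, h, Function.update_apply, hI]
  split_ifs <;> first | rfl | omega | simp_all

/-- Count the half-edge in register `10` at its vertex, if it is active; register `20` keeps the
maximum. -/
def degreeBody : Program :=
  .arith 13 .div (.reg 10) (.lit 2) ;;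
  .load 14 2 (.reg 13) ;;
  .ite (.eq (.reg 14) (.lit 0))
    (.load 15 3 (.reg 10) ;;
      .load 16 8 (.reg 15) ;;
      .arith 16 .add (.reg 16) (.lit 1) ;;
      .store 8 (.reg 15) (.reg 16) ;;
      .ite (.lt (.reg 20) (.reg 16)) (.move 20 (.reg 16)) .skip)
    .skip

/-- Compute the degrees and the maximum degree of the graph of the active edges. -/
def degrees : Program := .move 20 (.lit 0) ;; .forUpTo 10 2 degreeBody

theorem degrees_tr (hw : 4 * m + 4 < 2 ^ w) (h2 : s.reg 2 = 2 * m) (hs : ∀ x, s.arr 8 x = 0) :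
    Tr w degrees s (30 * (m + 1)) (fun s' =>
      (∀ x, s'.arr 8 x = colorCount (s.arr 3) m (s.arr 2) 0 x) ∧
      (∀ x, s'.arr 8 x ≤ s'.reg 20) ∧ (s'.reg 20 = 0 ∨ ∃ x, s'.arr 8 x = s'.reg 20)) := by
  refine Tr.mono (b := 1 + (14 * (2 * m) + 2)) (Tr.seq (Tr.mono (Tr.of_wp (k := 1)
    (by omega) rfl le_rfl (Q := fun s' => s' = s.setReg 20 0) (by simp)) le_rfl ?_))
    (by omega) (fun _ _ h => h)
  rintro s₁ - rfl -
  rw [← h2]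
  refine Tr.mono (Tr.forUpTo (k := 12) (by omega) (fun k s' =>
    (∀ x, s'.arr 8 x = ((Finset.range k).filter
      (fun h => s.arr 3 h = x ∧ s.arr 2 (h / 2) = 0)).card) ∧
    (∀ x, s'.arr 8 x ≤ s'.reg 20) ∧ (s'.reg 20 = 0 ∨ ∃ x, s'.arr 8 x = s'.reg 20))
    rfl rfl (by decide) (by simp; omega) ?_ ?_) le_rfl ?_
  · simp [hs]
  · rintro i s' hi hF hr ⟨hI1, hI2, hI3⟩
    have e2 : s'.arr 2 = s.arr 2 := hF.arr 2 rfl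
    have e3 : s'.arr 3 = s.arr 3 := hF.arr 3 rfl
    have hle : s'.arr 8 (s.arr 3 i) ≤ i := by
      rw [hI1]; exact (Finset.card_filter_le _ _).trans (by simp)
    simp only [State.setReg_reg, show (2 : ℕ) = 20 ↔ False by decide, if_false, h2] at hi
    have hcount : ∀ x, ((Finset.range (i + 1)).filter
        (fun h => s.arr 3 h = x ∧ s.arr 2 (h / 2) = 0)).card = s'.arr 8 x +
          if s.arr 3 i = x ∧ s.arr 2 (i / 2) = 0 then 1 else 0 := by
      intro x
      rw [hI1, Finset.card_filter, Finset.card_filter, Finset.sum_range_succ]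
    refine Tr.of_wp (by omega) rfl (by decide) ?_
    simp [degreeBody, hr, e2, e3, hcount]
    refine ⟨fun h0 => ⟨by omega, fun hlt => ⟨fun x => ?_, fun x => ?_, ⟨s.arr 3 i, by simp⟩⟩,
      fun hlt => ⟨fun x => ?_, fun x => ?_, ?_⟩⟩, fun h0 => ⟨h0, hI2, hI3⟩⟩
    · rcases eq_or_ne x (s.arr 3 i) with rfl | e
      · simp [h0]
      · simp [e, e.symm]
    · simp only [Function.update_apply]
      have := hI2 x
      split_ifs <;> omega
    · rcases eq_or_ne x (s.arr 3 i) with rfl | e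
      · simp [h0]
      · simp [e, e.symm]
    · simp only [Function.update_apply]
      have := hI2 x
      split_ifs <;> omega
    -- The cell that attains the maximum is not the one just raised, whose new value does not exceed
    -- the maximum.
    · right
      rcases hI3 with h | ⟨x, hx⟩
      · omega
      · refine ⟨x, ?_⟩
        rw [Function.update_of_ne]
        · exact hx
        · rintro rfl; omega
  · rintro s' _ ⟨h, h'⟩
    refine ⟨fun x => ?_, h'⟩
    rw [h x]
    simp [h2, colorCount]

/-- Give the weight in register `8` to the edge in register `10`, if it is active. -/
def weightBody : Program :=
  .load 13 2 (.reg 10) ;;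
  .ite (.eq (.reg 13) (.lit 0)) (.store 9 (.reg 10) (.reg 8)) (.store 9 (.reg 10) (.lit 0))

/-- Mark the edge in register `10` if its weight is odd. -/
def oddBody : Program :=
  .load 13 9 (.reg 10) ;;
  .arith 13 .mod (.reg 13) (.lit 2) ;;
  .store 4 (.reg 10) (.reg 13)

/-- Count the half-edge in register `10`, if its vertex has the maximum degree, in register `21` or
`22`, according to its color. -/
def countBody : Program :=
  .load 13 3 (.reg 10) ;;
  .load 14 8 (.reg 13) ;;
  .arith 15 .div (.reg 10) (.lit 2) ;;
  .load 16 7 (.reg 15) ;;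
  .ite (.eq (.reg 14) (.reg 3))
    (.ite (.eq (.reg 16) (.lit 1)) (.arith 21 .add (.reg 21) (.lit 1)) .skip ;;
      .ite (.eq (.reg 16) (.lit 2)) (.arith 22 .add (.reg 22) (.lit 1)) .skip)
    .skip

/-- Choose the color with the larger count. -/
def chooseColor : Program :=
  .move 21 (.lit 0) ;;
  .move 22 (.lit 0) ;;
  .forUpTo 10 2 countBody ;;
  .ite (.le (.reg 22) (.reg 21)) (.move 23 (.lit 1)) (.move 23 (.lit 2))

/-- Halve the weight of the edge in register `10`. -/
def halveBody : Program :=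
  .load 13 9 (.reg 10) ;;
  .arith 13 .div (.reg 13) (.lit 2) ;;
  .load 14 7 (.reg 10) ;;
  .ite (.eq (.reg 14) (.reg 23)) (.arith 13 .add (.reg 13) (.lit 1)) .skip ;;
  .store 9 (.reg 10) (.reg 13)

/-- Replace the weights by weights of half the size. -/
def halveWeights : Program :=
  .forUpTo 10 1 oddBody ;;
  split ;;
  chooseColor ;;
  .forUpTo 10 1 halveBody ;;
  .arith 7 .div (.reg 7) (.lit 2)

/-- Compute a matching that covers all vertices of degree `D`, as the edges of weight `1`. -/
def matching : Program :=
  degrees ;;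
  .arith 8 .div (.reg 6) (.reg 3) ;;
  .forUpTo 10 1 weightBody ;;
  .move 7 (.reg 6) ;;
  .loop (.lt (.lit 1) (.reg 7)) halveWeights ;;
  clearVertices 8

theorem chooseColor_tr (hw : 4 * m + 4 < 2 ^ w) (h2 : s.reg 2 = 2 * m) {a : ℕ → ℕ}
    (hs : ∀ x, s.arr 8 x = colorCount (s.arr 3) m a 0 x) :
    Tr w chooseColor s (40 * (m + 1)) (fun s' => ∃ c',
      (s'.reg 23 = 1 ∧ c' = 2 ∨ s'.reg 23 = 2 ∧ c' = 1) ∧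
      ((topHalves (s.arr 3) a m (s.reg 3)).filter (fun h => s.arr 7 (h / 2) = c')).card ≤
      ((topHalves (s.arr 3) a m (s.reg 3)).filter (fun h => s.arr 7 (h / 2) = s'.reg 23)).card) := by
  set cnt : ℕ → ℕ → ℕ := fun c k => ((Finset.range k).filter (fun h =>
    colorCount (s.arr 3) m a 0 (s.arr 3 h) = s.reg 3 ∧ s.arr 7 (h / 2) = c)).card with hcnt
  have hle : ∀ c k, cnt c k ≤ k := fun c k => (Finset.card_filter_le _ _).trans (by simp)
  have hsucc : ∀ c k, cnt c (k + 1) = cnt c k + if colorCount (s.arr 3) m a 0 (s.arr 3 k) = s.reg 3 ∧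
      s.arr 7 (k / 2) = c then 1 else 0 := by
    intro c k
    simp only [hcnt]
    rw [Finset.card_filter, Finset.card_filter, Finset.sum_range_succ]
  have htop : ∀ c, ((topHalves (s.arr 3) a m (s.reg 3)).filter
      (fun h => s.arr 7 (h / 2) = c)).card = cnt c (2 * m) := by
    intro c
    rw [topHalves, Finset.filter_filter]
  refine Tr.mono (b := 1 + (1 + (14 * (2 * m) + 2 + 2))) (Tr.seq (Tr.mono (Tr.of_wp (k := 1)
    (by omega) rfl le_rfl (Q := fun s' => s' = s.setReg 21 0) (by simp)) le_rfl ?_))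
    (by omega) (fun _ _ h => h)
  rintro s₁ - rfl -
  refine Tr.seq (Tr.mono (Tr.of_wp (k := 1)
    (by omega) rfl le_rfl (Q := fun s' => s' = (s.setReg 21 0).setReg 22 0) (by simp)) le_rfl ?_)
  rintro s₁ - rfl -
  rw [← h2]
  refine Tr.seq (Tr.mono (Tr.forUpTo (k := 12) (by omega) (fun k s' =>
    s'.reg 21 = cnt 1 k ∧ s'.reg 22 = cnt 2 k) rfl rfl (by decide) (by simp; omega) ?_ ?_) le_rfl ?_)
  · simp [hcnt]
  · rintro i s' hi hF hr ⟨hI1, hI2⟩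
    have e3 : s'.arr 3 = s.arr 3 := hF.arr 3 rfl
    have e7 : s'.arr 7 = s.arr 7 := hF.arr 7 rfl
    have e8 : s'.arr 8 = s.arr 8 := hF.arr 8 rfl
    have r3 : s'.reg 3 = s.reg 3 := (hF.reg 3 rfl).trans (by simp)
    have hi : i < 2 * m := by simpa [h2] using hi
    have l1 := hle 1 i
    have l2 := hle 2 i
    refine Tr.of_wp (by omega) rfl (by decide) ?_
    simp only [countBody, Program.wp, Operand.ev, Test.Ev, Op.Fits, Op.ev, State.setReg_reg,
      State.setReg_arr, hr, e3, e7, e8, r3, hI1, hI2, hs, hsucc]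
    by_cases ht : colorCount (s.arr 3) m a 0 (s.arr 3 i) = s.reg 3
    · by_cases c1 : s.arr 7 (i / 2) = 1
      · simp [ht, c1]; omega
      · by_cases c2 : s.arr 7 (i / 2) = 2
        · simp [ht, c2]; omega
        · simp [ht, c1, c2]
    · simp [ht]
  · rintro s' _ ⟨h, h'⟩ -
    have e : ((s.setReg 21 0).setReg 22 0).reg 2 = 2 * m := by simpa using h2
    rw [e] at h h'
    refine Tr.of_wp (by omega) rfl (by decide) ?_
    simp only [htop]
    simp [h, h']
    exact fun hc => hc.le

theorem halveWeights_tr (hw : 4 * m + 4 < 2 ^ w) (h1 : s.reg 1 = m) (h2 : s.reg 2 = 2 * m)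
    (hS : ∀ x, s.arr 5 x = 0) {a : ℕ → ℕ} (hs : ∀ x, s.arr 8 x = colorCount (s.arr 3) m a 0 x)
    (hE : ∃ β : ℕ → Bool, ∀ i < m, a i = 0 → β (s.arr 3 (2 * i)) ≠ β (s.arr 3 (2 * i + 1)))
    {q : ℕ} (hq : s.reg 7 = 2 * q) (hqw : 2 * q < 2 ^ w)
    (hW : Weights (s.arr 3) a m (s.reg 3) (2 * q) (s.arr 9)) :
    Tr w halveWeights s (200 * (m + 1)) (fun s' =>
      Weights (s.arr 3) a m (s.reg 3) q (s'.arr 9) ∧ s'.reg 7 = q ∧ ∀ x, s'.arr 5 x = 0) := by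
  rw [halveWeights]
  refine Tr.mono (b := (5 * m + 2) + (120 * (m + 1) + (40 * (m + 1) + ((9 * m + 2) + 1))))
    (Tr.seq ?_) (by omega) (fun _ _ h => h)
  rw [← h1]
  refine Tr.mono (Tr.fill (k := 3) (by omega) 4 (fun i => s.arr 9 i % 2) rfl rfl (by decide)
    (by omega) ?_) le_rfl ?_
  · intro i s' hi hF hr _
    have e9 : s'.arr 9 = s.arr 9 := hF.arr 9 rfl
    refine Tr.of_wp (by omega) rfl (by decide) ?_
    simp [oddBody, hr, e9]
  rw [h1]
  intro s₁ _ hodd hF₁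
  have r1 : s₁.reg 1 = m := (hF₁.reg 1 rfl).trans h1
  have r2 : s₁.reg 2 = 2 * m := (hF₁.reg 2 rfl).trans h2
  have r3 : s₁.reg 3 = s.reg 3 := hF₁.reg 3 rfl
  have r7 : s₁.reg 7 = 2 * q := (hF₁.reg 7 rfl).trans hq
  have a3 : s₁.arr 3 = s.arr 3 := hF₁.arr 3 rfl
  have a5 : s₁.arr 5 = s.arr 5 := hF₁.arr 5 rfl
  have a8 : s₁.arr 8 = s.arr 8 := hF₁.arr 8 rfl
  have a9 : s₁.arr 9 = s.arr 9 := hF₁.arr 9 rfl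
  refine Tr.seq (Tr.mono (split_tr hw r2 (by rwa [a5]) ?_) le_rfl ?_)
  · obtain ⟨β, hβ⟩ := hE
    refine ⟨β, fun i hi h => ?_⟩
    rw [a3]
    refine hβ i hi (hW.support i hi ?_)
    -- An odd weight is nonzero, so `Weights.support` makes the edge active.
    rw [hodd i hi] at h
    omega
  rintro s₂ _ ⟨hsplit, hS₂⟩ hF₂
  rw [a3] at hsplit
  replace r1 : s₂.reg 1 = m := (hF₂.reg 1 rfl).trans r1
  replace r2 : s₂.reg 2 = 2 * m := (hF₂.reg 2 rfl).trans r2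
  replace r3 : s₂.reg 3 = s.reg 3 := (hF₂.reg 3 rfl).trans r3
  replace r7 : s₂.reg 7 = 2 * q := (hF₂.reg 7 rfl).trans r7
  replace a3 : s₂.arr 3 = s.arr 3 := (hF₂.arr 3 rfl).trans a3
  replace a8 : s₂.arr 8 = s.arr 8 := (hF₂.arr 8 rfl).trans a8
  replace a9 : s₂.arr 9 = s.arr 9 := (hF₂.arr 9 rfl).trans a9
  refine Tr.seq (Tr.mono (chooseColor_tr (a := a) hw r2 (by rwa [a8, a3])) le_rfl ?_)
  rintro s₃ _ ⟨c', hc, hle⟩ hF₃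
  rw [a3, r3] at hle
  replace r1 : s₃.reg 1 = m := (hF₃.reg 1 rfl).trans r1
  replace r7 : s₃.reg 7 = 2 * q := (hF₃.reg 7 rfl).trans r7
  have a5 : s₃.arr 5 = s₂.arr 5 := hF₃.arr 5 rfl
  have a7 : s₃.arr 7 = s₂.arr 7 := hF₃.arr 7 rfl
  replace a9 : s₃.arr 9 = s.arr 9 := (hF₃.arr 9 rfl).trans a9
  refine Tr.seq ?_
  rw [← r1]
  refine Tr.mono (Tr.fill (k := 7) (by omega) 9
    (fun i => s.arr 9 i / 2 + if s₂.arr 7 i = s₃.reg 23 then 1 else 0) rfl rfl (by decide)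
    (by omega) ?_) le_rfl ?_
  · intro i s' hi hF hr hi9
    rw [r1] at hi
    have e7 : s'.arr 7 = s₂.arr 7 := (hF.arr 7 rfl).trans a7
    have r23 : s'.reg 23 = s₃.reg 23 := hF.reg 23 rfl
    have hwi := hW.apply_le hi
    rw [a9] at hi9
    refine Tr.of_wp (by omega) rfl (by decide) ?_
    simp [halveBody, hr, e7, r23, hi9]
    exact ⟨fun h => ⟨by omega, by simp [h]⟩, fun h => by simp [h]⟩
  rw [r1]
  intro s₄ _ hwt hF₄
  replace r7 : s₄.reg 7 = 2 * q := (hF₄.reg 7 rfl).trans r7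
  replace a5 : s₄.arr 5 = s₂.arr 5 := (hF₄.arr 5 rfl).trans a5
  refine Tr.of_wp (by omega) rfl (by decide) ?_
  simp [r7, a5]
  exact ⟨hW.halve hodd hsplit hc hle hwt, hS₂⟩

theorem matching_tr (hw : 4 * m + 4 < 2 ^ w) (h1 : s.reg 1 = m) (h2 : s.reg 2 = 2 * m)
    (hS : ∀ x, s.arr 5 x = 0) (hd : ∀ x, s.arr 8 x = 0)
    (hE : ∃ β : ℕ → Bool, ∀ i < m, s.arr 2 i = 0 → β (s.arr 3 (2 * i)) ≠ β (s.arr 3 (2 * i + 1)))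
    {j : ℕ} (h6 : s.reg 6 = 2 ^ j) (hj : 2 * m < 2 ^ j) (hj' : 2 ^ j < 2 ^ w) (hD : 0 < s.reg 3)
    (hdeg : ∀ x, colorCount (s.arr 3) m (s.arr 2) 0 x ≤ s.reg 3) :
    Tr w matching s (260 * (m + 1) * (j + 1)) (fun s' =>
      Matching (s.arr 3) (s.arr 2) m (s.reg 3) (s'.arr 9) ∧
      (∀ x, s'.arr 5 x = 0) ∧ ∀ x, s'.arr 8 x = 0) := by
  rw [matching]
  refine Tr.mono (b := 30 * (m + 1) + (1 + ((5 * m + 2) + (1 + (((200 * (m + 1) + 1) * j + 1) +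
    (8 * m + 2)))))) (Tr.seq ?_) (by nlinarith [Nat.zero_le (m * j)]) (fun _ _ h => h)
  refine Tr.mono (degrees_tr hw h2 hd) le_rfl ?_
  rintro s₁ _ ⟨hdg, -, -⟩ hF₁
  have r1 : s₁.reg 1 = m := (hF₁.reg 1 rfl).trans h1
  have r2 : s₁.reg 2 = 2 * m := (hF₁.reg 2 rfl).trans h2
  have r3 : s₁.reg 3 = s.reg 3 := hF₁.reg 3 rfl
  have r6 : s₁.reg 6 = 2 ^ j := (hF₁.reg 6 rfl).trans h6
  have a2 : s₁.arr 2 = s.arr 2 := hF₁.arr 2 rfl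
  have a3 : s₁.arr 3 = s.arr 3 := hF₁.arr 3 rfl
  have a5 : s₁.arr 5 = s.arr 5 := hF₁.arr 5 rfl
  refine Tr.seq (Tr.mono (Tr.of_wp (k := 1) (by omega) rfl le_rfl
    (Q := fun s₂ => s₂ = s₁.setReg 8 (2 ^ j / s.reg 3)) (by simp [r6, r3])) le_rfl ?_)
  rintro s₂ - rfl -
  refine Tr.seq ?_
  have r1' : (s₁.setReg 8 (2 ^ j / s.reg 3)).reg 1 = m := by simpa using r1
  rw [← r1']
  refine Tr.mono (Tr.fill (k := 3) (by omega) 9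
    (fun i => if s.arr 2 i = 0 then 2 ^ j / s.reg 3 else 0) rfl rfl (by decide)
    (by omega) ?_) le_rfl ?_
  · intro i s' hi hF hr _
    have e2 : s'.arr 2 = s.arr 2 := (hF.arr 2 rfl).trans a2
    have r8 : s'.reg 8 = 2 ^ j / s.reg 3 := (hF.reg 8 rfl).trans (by simp)
    refine Tr.of_wp (by omega) rfl (by decide) ?_
    simp [weightBody, hr, e2, r8]
    exact ⟨fun h => by simp [h], fun h => by simp [h]⟩
  rw [r1']
  intro s₃ _ hwt hF₃
  replace r1 : s₃.reg 1 = m := (hF₃.reg 1 rfl).trans r1'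
  replace r2 : s₃.reg 2 = 2 * m := (hF₃.reg 2 rfl).trans (by simpa using r2)
  replace r3 : s₃.reg 3 = s.reg 3 := (hF₃.reg 3 rfl).trans (by simpa using r3)
  replace r6 : s₃.reg 6 = 2 ^ j := (hF₃.reg 6 rfl).trans (by simpa using r6)
  replace a3 : s₃.arr 3 = s.arr 3 := (hF₃.arr 3 rfl).trans a3
  replace a5 : s₃.arr 5 = s.arr 5 := (hF₃.arr 5 rfl).trans a5
  have a8 : s₃.arr 8 = s₁.arr 8 := hF₃.arr 8 rfl
  have hW := Weights.init hD hdeg hj hwt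
  refine Tr.seq (Tr.mono (Tr.of_wp (k := 1) (by omega) rfl le_rfl
    (Q := fun s₄ => s₄ = s₃.setReg 7 (2 ^ j)) (by simp [r6])) le_rfl ?_)
  rintro s₄ - rfl -
  -- Register `7` runs down the powers of two, so its logarithm counts the remaining halvings.
  have hΦ : Nat.log 2 ((s₃.setReg 7 (2 ^ j)).reg 7) = j := by
    simp [Nat.log_pow]
  rw [show (200 * (m + 1) + 1) * j + 1 = (200 * (m + 1) + 1) *
    Nat.log 2 ((s₃.setReg 7 (2 ^ j)).reg 7) + 1 by rw [hΦ]]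
  refine Tr.seq (Tr.mono (Tr.loop (fun s' => (∃ l ≤ j, s'.reg 7 = 2 ^ l) ∧
    Weights (s.arr 3) (s.arr 2) m (s.reg 3) (s'.reg 7) (s'.arr 9) ∧ ∀ x, s'.arr 5 x = 0)
    (fun s' => Nat.log 2 (s'.reg 7)) ?_ ?_) le_rfl ?_)
  · exact ⟨⟨j, le_rfl, by simp⟩, by simpa using hW, by simpa [a5] using hS⟩
  · rintro s' hF ⟨⟨l, hl, hl7⟩, hW', hS'⟩ hc
    simp only [Test.Holds, Operand.val, hl7, Nat.mod_eq_of_lt (show 1 < 2 ^ w by omega)] at hc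
    obtain ⟨l, rfl⟩ : ∃ k, l = k + 1 := Nat.exists_eq_succ_of_ne_zero (by rintro rfl; simp at hc)
    have e3 : s'.arr 3 = s.arr 3 := (hF.arr 3 rfl).trans a3
    have e8 : s'.arr 8 = s₁.arr 8 := (hF.arr 8 rfl).trans a8
    have f1 : s'.reg 1 = m := (hF.reg 1 rfl).trans (by simpa using r1)
    have f2 : s'.reg 2 = 2 * m := (hF.reg 2 rfl).trans (by simpa using r2)
    have f3 : s'.reg 3 = s.reg 3 := (hF.reg 3 rfl).trans (by simpa using r3)
    have hpow : 2 ^ (l + 1) ≤ 2 ^ j := Nat.pow_le_pow_right (by omega) hl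
    have hq : s'.reg 7 = 2 * 2 ^ l := by rw [hl7]; ring
    rw [hq] at hW'
    refine Tr.mono (halveWeights_tr (a := s.arr 2) (q := 2 ^ l) hw f1 f2 hS'
      (by rw [e8, e3]; exact hdg) (by rwa [e3]) hq (by rw [← hq]; omega)
      (by rwa [e3, f3])) le_rfl ?_
    rintro s'' - ⟨g1, g2, g3⟩
    rw [e3, f3] at g1
    refine ⟨⟨⟨l, by omega, g2⟩, by rwa [g2], g3⟩, ?_⟩
    rw [g2, hl7, Nat.log_pow (by omega), Nat.log_pow (by omega)]
    omega
  rintro s₅ _ ⟨⟨⟨l, hl, hl7⟩, hW', hS'⟩, hc⟩ hF₅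
  simp only [Test.Holds, Operand.val, Nat.mod_eq_of_lt (show 1 < 2 ^ w by omega)] at hc
  have h1 : s₅.reg 7 = 1 := by
    have : 0 < 2 ^ l := by positivity
    omega
  rw [h1] at hW'
  have e3 : s₅.arr 3 = s.arr 3 := (hF₅.arr 3 rfl).trans a3
  have e8 : s₅.arr 8 = s₁.arr 8 := (hF₅.arr 8 rfl).trans a8
  have f2 : s₅.reg 2 = 2 * m := (hF₅.reg 2 rfl).trans (by simpa using r2)
  refine Tr.mono (clearVertices_tr 8 (by decide) hw f2 ?_) le_rfl ?_
  · intro x hx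
    rw [e8, hdg, ← Nat.pos_iff_ne_zero] at hx
    obtain ⟨h, hh⟩ := Finset.card_pos.1 hx
    simp only [Finset.mem_filter, Finset.mem_range] at hh
    exact ⟨h, hh.1, by rw [e3]; exact hh.2.1⟩
  · intro s₆ hF₆ h8
    rw [hF₆.arr 9 rfl, hF₆.arr 5 rfl]
    exact ⟨hW'.matching hD, hS', h8⟩

end WordRAM

/-! ### Colorings level by level

The active edges are divided into `K` classes of maximum degree at most `D`. The half-edge `h`, at
the vertex `v h` of the graph, is attached to the vertex `E h = v h * K + c` if its edge is in
class `c`. The colors used so far are at most `o`. -/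

namespace BalancedSplit

/-- A valid partial coloring `a` and a division of the uncolored edges into classes. -/
structure Level (v : ℕ → ℕ) (m K D o : ℕ) (E a : ℕ → ℕ) : Prop where
  vertex : ∀ h < 2 * m, E h / K = v h
  cls : ∀ i < m, a i = 0 → E (2 * i) % K = E (2 * i + 1) % K
  deg : ∀ x, colorCount E m a 0 x ≤ D
  le : ∀ i < m, a i ≤ o
  valid : ∀ h < 2 * m, ∀ g < 2 * m, h / 2 ≠ g / 2 → v h = v g → a (h / 2) ≠ 0 →
    a (h / 2) ≠ a (g / 2)

variable {v E E' a a' F col wt : ℕ → ℕ} {m K D o : ℕ}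

theorem Level.cls_half (hL : Level v m K D o E a) {h : ℕ} (hh : h < 2 * m) (h0 : a (h / 2) = 0) :
    E (2 * (h / 2)) % K = E h % K := by
  rcases Nat.mod_two_eq_zero_or_one h with e | e
  · rw [show 2 * (h / 2) = h by omega]
  · rw [hL.cls _ (by omega) h0, show 2 * (h / 2) + 1 = h by omega]

/-- The copies of a vertex in the various classes inherit its side. -/
theorem Level.bipartite (hL : Level v m K D o E a)
    (hv : ∃ β : ℕ → Bool, ∀ i < m, β (v (2 * i)) ≠ β (v (2 * i + 1))) :
    ∃ β : ℕ → Bool, ∀ i < m, β (E (2 * i)) ≠ β (E (2 * i + 1)) := by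
  obtain ⟨β, hβ⟩ := hv
  refine ⟨fun x => β (x / K), fun i hi => ?_⟩
  simp only
  rw [hL.vertex _ (by omega), hL.vertex _ (by omega)]
  exact hβ i hi

/-- The edges of a matching receive a new color for each class. -/
theorem Level.color_matching (hL : Level v m K D o E a) (hK : 0 < K)
    (hM : Matching E a m D wt)
    (ha : ∀ i < m, a' i = if wt i = 1 then o + E (2 * i) % K + 1 else a i) :
    Level v m K (D - 1) (o + K) E a' := by
  have hpos : ∀ i < m, wt i = 1 → a' i = o + E (2 * i) % K + 1 := fun i hi h => by
    rw [ha i hi, if_pos h]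
  have hneg : ∀ i < m, wt i ≠ 1 → a' i = a i := fun i hi h => by rw [ha i hi, if_neg h]
  refine ⟨hL.vertex, fun i hi h => ?_, fun x => ?_, fun i hi => ?_, fun h hh g hg hne hv h0 => ?_⟩
  · by_cases h1 : wt i = 1
    · rw [hpos i hi h1] at h; omega
    · exact hL.cls i hi (by rw [← hneg i hi h1]; exact h)
  · have := hM.colorCount_lt hL.deg (fun i hi h => by rw [hpos i hi h]; omega) hneg x
    omega
  · have := Nat.mod_lt (E (2 * i)) hK
    have := hL.le i hi
    rw [ha i hi]
    split_ifs <;> omega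
  · have hi : h / 2 < m := by omega
    have hj : g / 2 < m := by omega
    have l1 := hL.le _ hi
    have l2 := hL.le _ hj
    by_cases w1 : wt (h / 2) = 1 <;> by_cases w2 : wt (g / 2) = 1
    · rw [hpos _ hi w1, hpos _ hj w2]
      intro he
      -- Equal new colors mean equal classes; together with the common vertex this gives the same
      -- vertex of the matching's graph, so the two edges coincide.
      have he : E (2 * (h / 2)) % K = E (2 * (g / 2)) % K := by omega
      rw [hL.cls_half hh (hM.active _ hi w1), hL.cls_half hg (hM.active _ hj w2)] at he
      have hd : E h / K = E g / K := by rw [hL.vertex h hh, hL.vertex g hg, hv]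
      have hE : E h = E g := by
        rw [← Nat.div_add_mod (E h) K, ← Nat.div_add_mod (E g) K, hd, he]
      exact hne (by rw [hM.disjoint h hh g hg w1 w2 hE])
    · rw [hpos _ hi w1, hneg _ hj w2]; omega
    · rw [hneg _ hi w1, hpos _ hj w2]; omega
    · rw [hneg _ hi w1] at h0 ⊢
      rw [hneg _ hj w2]
      exact hL.valid h hh g hg hne hv h0

/-- Every class is split into two. -/
theorem Level.split (hL : Level v m K (2 * D) o E a) (hs : IsSplit E F m col)
    (hF : ∀ i < m, F i = if a i = 0 then 1 else 0)
    (hE : ∀ h < 2 * m, E' h = 2 * E h + if col (h / 2) = 2 then 1 else 0) :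
    Level v m (2 * K) D o E' a := by
  refine ⟨fun h hh => ?_, fun i hi h => ?_, fun x => ?_, hL.le, hL.valid⟩
  · rw [← hL.vertex h hh, ← Nat.div_div_eq_div_mul, hE h hh]
    congr 1
    split_ifs <;> omega
  · have := hL.cls i hi h
    rw [hE _ (by omega), hE _ (by omega), show 2 * i / 2 = i by omega,
      show (2 * i + 1) / 2 = i by omega]
    split_ifs
    · rw [Nat.mod_mul, Nat.mod_mul]
      rw [show (2 * E (2 * i) + 1) / 2 = E (2 * i) by omega,
        show (2 * E (2 * i + 1) + 1) / 2 = E (2 * i + 1) by omega, this]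
      omega
    · rw [add_zero, add_zero, Nat.mul_mod_mul_left, Nat.mul_mod_mul_left, this]
  · have h1 := hs.one_le (x / 2)
    have h2 := hs.two_le (x / 2)
    have h3 := hL.deg (x / 2)
    have hact : ∀ h < 2 * m, a (h / 2) = 0 → col (h / 2) = 1 ∨ col (h / 2) = 2 := fun h hh h0 =>
      hs.mem _ (by omega) (by rw [hF _ (by omega), if_pos h0])
    have hina : ∀ h < 2 * m, col (h / 2) ≠ 0 → a (h / 2) = 0 := fun h hh h0 => by
      by_contra hc
      exact h0 (hs.not_mem _ (by omega) (by rw [hF _ (by omega), if_neg hc]; decide))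
    have h4 : colorCount E m col 1 (x / 2) + colorCount E m col 2 (x / 2) ≤
        colorCount E m a 0 (x / 2) := by
      unfold colorCount
      rw [← Finset.card_union_of_disjoint]
      · refine Finset.card_le_card fun h => ?_
        simp only [Finset.mem_union, Finset.mem_filter, Finset.mem_range]
        rintro (⟨g1, g2, g3⟩ | ⟨g1, g2, g3⟩) <;>
          exact ⟨g1, g2, hina h g1 (by omega)⟩
      · rw [Finset.disjoint_left]
        simp only [Finset.mem_filter, Finset.mem_range]
        rintro h ⟨_, _, g⟩ ⟨_, _, g'⟩
        omega
    -- Even `x` receives the edges of color `1` at `x / 2`, odd `x` those of color `2`. Both counts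
    -- are at most `D`, as they sum to at most `2 * D` and differ by at most one.
    have h5 : colorCount E' m a 0 x ≤ max (colorCount E m col 1 (x / 2))
        (colorCount E m col 2 (x / 2)) := by
      rcases Nat.mod_two_eq_zero_or_one x with e | e
      · refine le_max_of_le_left (Finset.card_le_card fun h => ?_)
        simp only [Finset.mem_filter, Finset.mem_range]
        rintro ⟨g1, g2, g3⟩
        rw [hE h g1] at g2
        have := hact h g1 g3
        refine ⟨g1, ?_, ?_⟩ <;> split_ifs at g2 <;> omega
      · refine le_max_of_le_right (Finset.card_le_card fun h => ?_)
        simp only [Finset.mem_filter, Finset.mem_range]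
        rintro ⟨g1, g2, g3⟩
        rw [hE h g1] at g2
        have := hact h g1 g3
        refine ⟨g1, ?_, ?_⟩ <;> split_ifs at g2 <;> omega
    omega

theorem Level.init (h0 : ∀ i < m, a i = 0) (hE : ∀ h < 2 * m, E h = v h)
    (hdeg : ∀ x, colorCount E m a 0 x ≤ D) : Level v m 1 D 0 E a :=
  ⟨fun h hh => by rw [hE h hh, Nat.div_one], fun i hi _ => by rw [Nat.mod_one, Nat.mod_one], hdeg,
    fun i hi => (h0 i hi).le, fun h hh _ _ _ _ h1 => absurd (h0 _ (by omega)) h1⟩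

/-- An active edge would give its endpoint a positive degree. -/
theorem Level.colored (hL : Level v m K 0 o E a) {i : ℕ} (hi : i < m) : a i ≠ 0 := by
  intro h0
  have h1 := hL.deg (E (2 * i))
  rw [Nat.le_zero, colorCount, Finset.card_eq_zero] at h1
  have h2 : 2 * i ∈ (Finset.range (2 * m)).filter
      (fun h => E h = E (2 * i) ∧ a (h / 2) = 0) := by
    simp only [Finset.mem_filter, Finset.mem_range, true_and]
    exact ⟨by omega, by rwa [show 2 * i / 2 = i by omega]⟩
  rw [h1] at h2
  simp at h2

end BalancedSplit

/-! ### One level on the word RAM: removing matchings and halving degrees -/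

namespace WordRAM

open BalancedSplit

/-- Color the edge in register `10`, if it is in the matching. -/
def colorBody : Program :=
  .load 13 9 (.reg 10) ;;
  .ite (.eq (.reg 13) (.lit 1))
    (.arith 14 .mul (.lit 2) (.reg 10) ;;
      .load 15 3 (.reg 14) ;;
      .arith 15 .mod (.reg 15) (.reg 4) ;;
      .arith 15 .add (.reg 5) (.reg 15) ;;
      .arith 15 .add (.reg 15) (.lit 1) ;;
      .store 2 (.reg 10) (.reg 15))
    .skip

/-- If the degree bound is odd, color the edges of a matching. -/
def oddStep : Program :=
  .arith 13 .mod (.reg 3) (.lit 2) ;;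
  .ite (.eq (.reg 13) (.lit 1))
    (matching ;; .forUpTo 10 1 colorBody ;; .arith 5 .add (.reg 5) (.reg 4))
    .skip

/-- Mark the edge in register `10` if it is active. -/
def activeBody : Program :=
  .load 13 2 (.reg 10) ;;
  .ite (.eq (.reg 13) (.lit 0)) (.store 4 (.reg 10) (.lit 1)) (.store 4 (.reg 10) (.lit 0))

/-- Update the vertex of the half-edge in register `10`. -/
def vertexBody : Program :=
  .load 13 3 (.reg 10) ;;
  .arith 14 .div (.reg 10) (.lit 2) ;;
  .load 15 7 (.reg 14) ;;
  .arith 13 .mul (.lit 2) (.reg 13) ;;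
  .ite (.eq (.reg 15) (.lit 2)) (.arith 13 .add (.reg 13) (.lit 1)) .skip ;;
  .store 3 (.reg 10) (.reg 13)

/-- Split every class into two. -/
def evenStep : Program :=
  .forUpTo 10 1 activeBody ;;
  split ;;
  .forUpTo 10 2 vertexBody ;;
  .arith 3 .div (.reg 3) (.lit 2) ;;
  .arith 4 .add (.reg 4) (.reg 4)

variable {w n m Δ j : ℕ} {v : ℕ → ℕ} {s : State}

/-- The state before and after each level. -/
structure AtLevel (v : ℕ → ℕ) (m Δ j D : ℕ) (s : State) : Prop where
  reg_one : s.reg 1 = m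
  reg_two : s.reg 2 = 2 * m
  reg_six : s.reg 6 = 2 ^ j
  slots : ∀ x, s.arr 5 x = 0
  degs : ∀ x, s.arr 8 x = 0
  pos : 0 < s.reg 4
  sum : s.reg 4 * D + s.reg 5 = Δ
  level : Level v m (s.reg 4) D (s.reg 5) (s.arr 3) (s.arr 2)

/-- Register `3` keeps its possibly odd value although the degree bound drops to the even number
below it; the division in `evenStep` gives the same result for both. This is why `AtLevel` takes the
bound as a separate argument. -/
theorem oddStep_tr (hw : 4 * m + 4 < 2 ^ w) (hΔ : Δ ≤ 2 * m) (hj : 2 * m < 2 ^ j)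
    (hj' : 2 ^ j < 2 ^ w) (hv : ∃ β : ℕ → Bool, ∀ i < m, β (v (2 * i)) ≠ β (v (2 * i + 1)))
    (hs : AtLevel v m Δ j (s.reg 3) s) :
    Tr w oddStep s (280 * (m + 1) * (j + 1)) (fun s' =>
      s'.reg 3 = s.reg 3 ∧ s'.reg 4 = s.reg 4 ∧ AtLevel v m Δ j (2 * (s.reg 3 / 2)) s') := by
  obtain ⟨h1, h2, h6, hS, hd, hK, hsum, hL⟩ := hs
  rw [oddStep]
  refine Tr.mono (b := 1 + (260 * (m + 1) * (j + 1) + ((12 * m + 2) + 1) + 1))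
    (Tr.seq (Tr.mono (Tr.of_wp (k := 1) (by omega) rfl le_rfl
    (Q := fun s₁ => s₁ = s.setReg 13 (s.reg 3 % 2)) (by simp)) le_rfl ?_)) ?_ (fun _ _ h => h)
  swap
  · nlinarith [Nat.zero_le (m * j)]
  rintro s₁ - rfl -
  refine Tr.ite (fun hc => ?_) (fun hc => ?_)
  · have hodd : s.reg 3 % 2 = 1 := by
      simpa [Test.Holds, Operand.val, Nat.mod_eq_of_lt (show 1 < 2 ^ w by omega)] using hc
    obtain ⟨β, hβ⟩ := hL.bipartite hv
    refine Tr.seq (Tr.mono (matching_tr (s := s.setReg 13 (s.reg 3 % 2)) (j := j) hw (by simpa using h1) (by simpa using h2) hS hd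
      ⟨β, fun i hi _ => hβ i hi⟩ (by simpa using h6) hj hj' (by simp; omega)
      (by simpa using hL.deg)) le_rfl ?_)
    rintro s₂ _ ⟨hM, hS₂, hd₂⟩ hF₂
    have r1 : s₂.reg 1 = m := (hF₂.reg 1 rfl).trans (by simpa using h1)
    have r2 : s₂.reg 2 = 2 * m := (hF₂.reg 2 rfl).trans (by simpa using h2)
    have r3 : s₂.reg 3 = s.reg 3 := (hF₂.reg 3 rfl).trans (by simp)
    have r4 : s₂.reg 4 = s.reg 4 := (hF₂.reg 4 rfl).trans (by simp)
    have r5 : s₂.reg 5 = s.reg 5 := (hF₂.reg 5 rfl).trans (by simp)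
    have r6 : s₂.reg 6 = 2 ^ j := (hF₂.reg 6 rfl).trans (by simpa using h6)
    have a2 : s₂.arr 2 = s.arr 2 := hF₂.arr 2 rfl
    have a3 : s₂.arr 3 = s.arr 3 := hF₂.arr 3 rfl
    simp only [State.setReg_arr, State.setReg_reg, show (3 : ℕ) = 13 ↔ False by decide,
      if_false] at hM
    -- An odd `D` is at least `1`, so `K * D + o = Δ` leaves room for `K` new colors; this also
    -- excludes overflow.
    have hKD : s.reg 4 + s.reg 5 ≤ Δ := by
      have : s.reg 4 * 1 ≤ s.reg 4 * s.reg 3 := Nat.mul_le_mul_left _ (by omega)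
      omega
    refine Tr.seq ?_
    rw [← r1]
    refine Tr.mono (Tr.fill (k := 10) (by omega) 2 (fun i => if s₂.arr 9 i = 1 then
      s.reg 5 + s.arr 3 (2 * i) % s.reg 4 + 1 else s.arr 2 i) rfl rfl (by decide)
      (by omega) ?_) le_rfl ?_
    · intro i s' hi hF hr hi2
      have e3 : s'.arr 3 = s.arr 3 := (hF.arr 3 rfl).trans a3
      have e9 : s'.arr 9 = s₂.arr 9 := hF.arr 9 rfl
      have f4 : s'.reg 4 = s.reg 4 := (hF.reg 4 rfl).trans r4
      have f5 : s'.reg 5 = s.reg 5 := (hF.reg 5 rfl).trans r5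
      have hlt := Nat.mod_lt (s.arr 3 (2 * i)) hK
      rw [a2] at hi2
      refine Tr.of_wp (by omega) rfl (by decide) ?_
      simp [colorBody, hr, e3, e9, f4, f5]
      refine ⟨fun h => ⟨by omega, by omega, by omega, by simp [h]⟩, fun h => ?_⟩
      simp only [h, if_false]
      exact hi2
    rw [r1]
    intro s₃ _ hcol hF₃
    have f1 : s₃.reg 1 = m := (hF₃.reg 1 rfl).trans r1
    have f2 : s₃.reg 2 = 2 * m := (hF₃.reg 2 rfl).trans r2
    have f3 : s₃.reg 3 = s.reg 3 := (hF₃.reg 3 rfl).trans r3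
    have f4 : s₃.reg 4 = s.reg 4 := (hF₃.reg 4 rfl).trans r4
    have f5 : s₃.reg 5 = s.reg 5 := (hF₃.reg 5 rfl).trans r5
    have f6 : s₃.reg 6 = 2 ^ j := (hF₃.reg 6 rfl).trans r6
    have b3 : s₃.arr 3 = s.arr 3 := (hF₃.arr 3 rfl).trans a3
    have b5 : s₃.arr 5 = s₂.arr 5 := hF₃.arr 5 rfl
    have b8 : s₃.arr 8 = s₂.arr 8 := hF₃.arr 8 rfl
    have hL' := hL.color_matching hK hM hcol
    have hD : s.reg 3 - 1 = 2 * (s.reg 3 / 2) := by omega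
    have hD' : s.reg 3 = 2 * (s.reg 3 / 2) + 1 := by omega
    rw [hD] at hL'
    refine Tr.of_wp (by omega) rfl (by decide) ?_
    simp [f4, f5]
    refine ⟨by omega, f3, ⟨by simpa using f1, by simpa using f2, by simpa using f6,
      by simpa [b5] using hS₂, by simpa [b8] using hd₂, by simpa [f4] using hK, ?_,
      by simpa [f4, b3] using hL'⟩⟩
    simp only [State.setReg_reg, show (4 : ℕ) = 5 ↔ False by decide, if_false, if_true, f4]
    rw [hD', Nat.mul_add] at hsum
    omega
  · have heven : s.reg 3 = 2 * (s.reg 3 / 2) := by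
      have : s.reg 3 % 2 ≠ 1 := by
        simpa [Test.Holds, Operand.val, Nat.mod_eq_of_lt (show 1 < 2 ^ w by omega)] using hc
      omega
    refine Tr.of_wp (by omega) rfl (show _ ≤ _ from Nat.le_add_left _ _) ?_
    refine ⟨by simp, by simp, ?_⟩
    rw [← heven]
    exact ⟨by simpa using h1, by simpa using h2, by simpa using h6, hS, hd, by simpa using hK,
      by simpa using hsum, by simpa using hL⟩

theorem evenStep_tr (hw : 4 * m + 4 < 2 ^ w) (hn : 4 * n * m ≤ 2 ^ w) (hΔ : Δ ≤ 2 * m)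
    (hv : ∃ β : ℕ → Bool, ∀ i < m, β (v (2 * i)) ≠ β (v (2 * i + 1)))
    (hvn : ∀ h < 2 * m, v h < n) (hK : s.reg 4 ≤ Δ)
    (hs : AtLevel v m Δ j (2 * (s.reg 3 / 2)) s) :
    Tr w evenStep s (170 * (m + 1)) (fun s' =>
      s'.reg 3 = s.reg 3 / 2 ∧ AtLevel v m Δ j (s'.reg 3) s') := by
  obtain ⟨h1, h2, h6, hS, hd, hpos, hsum, hL⟩ := hs
  -- Vertex numbers are below `n * K` with `K ≤ Δ ≤ 2 * m`, so the doubled ones stay below `4 * n *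
  -- m`.
  have hEb : ∀ h < 2 * m, 2 * s.arr 3 h + 1 < 2 ^ w := by
    intro h hh
    have e1 := hL.vertex h hh
    have e2 : s.arr 3 h < n * s.reg 4 := by
      rw [← Nat.div_lt_iff_lt_mul hpos, e1]; exact hvn h hh
    have e3 : n * s.reg 4 ≤ n * (2 * m) := Nat.mul_le_mul_left _ (by omega)
    have e4 : 4 * n * m = 2 * (n * (2 * m)) := by ring
    omega
  obtain ⟨β, hβ⟩ := hL.bipartite hv
  rw [evenStep]
  refine Tr.mono (b := (5 * m + 2) + (120 * (m + 1) + ((10 * (2 * m) + 2) + (1 + 1))))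
    (Tr.seq ?_) (by omega) (fun _ _ h => h)
  rw [← h1]
  refine Tr.mono (Tr.fill (k := 3) (by omega) 4 (fun i => if s.arr 2 i = 0 then 1 else 0)
    rfl rfl (by decide) (by omega) ?_) le_rfl ?_
  · intro i s' hi hF hr _
    have e2 : s'.arr 2 = s.arr 2 := hF.arr 2 rfl
    refine Tr.of_wp (by omega) rfl (by decide) ?_
    simp [activeBody, hr, e2]
    exact ⟨fun h => by simp [h], fun h => by simp [h]⟩
  rw [h1]
  intro s₁ _ hact hF₁
  have r1 : s₁.reg 1 = m := (hF₁.reg 1 rfl).trans h1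
  have r2 : s₁.reg 2 = 2 * m := (hF₁.reg 2 rfl).trans h2
  have r3 : s₁.reg 3 = s.reg 3 := hF₁.reg 3 rfl
  have r4 : s₁.reg 4 = s.reg 4 := hF₁.reg 4 rfl
  have r5 : s₁.reg 5 = s.reg 5 := hF₁.reg 5 rfl
  have r6 : s₁.reg 6 = 2 ^ j := (hF₁.reg 6 rfl).trans h6
  have a2 : s₁.arr 2 = s.arr 2 := hF₁.arr 2 rfl
  have a3 : s₁.arr 3 = s.arr 3 := hF₁.arr 3 rfl
  have a5 : s₁.arr 5 = s.arr 5 := hF₁.arr 5 rfl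
  have a8 : s₁.arr 8 = s.arr 8 := hF₁.arr 8 rfl
  refine Tr.seq (Tr.mono (split_tr hw r2 (by rwa [a5])
    ⟨β, fun i hi _ => by rw [a3]; exact hβ i hi⟩) le_rfl ?_)
  rintro s₂ _ ⟨hsplit, hS₂⟩ hF₂
  rw [a3] at hsplit
  replace r1 : s₂.reg 1 = m := (hF₂.reg 1 rfl).trans r1
  replace r2 : s₂.reg 2 = 2 * m := (hF₂.reg 2 rfl).trans r2
  replace r3 : s₂.reg 3 = s.reg 3 := (hF₂.reg 3 rfl).trans r3
  replace r4 : s₂.reg 4 = s.reg 4 := (hF₂.reg 4 rfl).trans r4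
  replace r5 : s₂.reg 5 = s.reg 5 := (hF₂.reg 5 rfl).trans r5
  replace r6 : s₂.reg 6 = 2 ^ j := (hF₂.reg 6 rfl).trans r6
  replace a2 : s₂.arr 2 = s.arr 2 := (hF₂.arr 2 rfl).trans a2
  replace a3 : s₂.arr 3 = s.arr 3 := (hF₂.arr 3 rfl).trans a3
  replace a8 : s₂.arr 8 = s.arr 8 := (hF₂.arr 8 rfl).trans a8
  refine Tr.seq ?_
  rw [← r2]
  refine Tr.mono (Tr.fill (k := 8) (by omega) 3
    (fun h => 2 * s.arr 3 h + if s₂.arr 7 (h / 2) = 2 then 1 else 0) rfl rfl (by decide)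
    (by omega) ?_) le_rfl ?_
  · intro i s' hi hF hr hi3
    rw [r2] at hi
    have e7 : s'.arr 7 = s₂.arr 7 := hF.arr 7 rfl
    have hlt := hEb i hi
    rw [a3] at hi3
    refine Tr.of_wp (by omega) rfl (by decide) ?_
    simp [vertexBody, hr, e7, hi3]
    exact ⟨by omega, fun h => ⟨by omega, by simp [h]⟩, fun h => by simp [h]⟩
  rw [r2]
  intro s₃ _ hE hF₃
  replace r1 : s₃.reg 1 = m := (hF₃.reg 1 rfl).trans r1
  replace r2 : s₃.reg 2 = 2 * m := (hF₃.reg 2 rfl).trans r2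
  replace r3 : s₃.reg 3 = s.reg 3 := (hF₃.reg 3 rfl).trans r3
  replace r4 : s₃.reg 4 = s.reg 4 := (hF₃.reg 4 rfl).trans r4
  replace r5 : s₃.reg 5 = s.reg 5 := (hF₃.reg 5 rfl).trans r5
  replace r6 : s₃.reg 6 = 2 ^ j := (hF₃.reg 6 rfl).trans r6
  replace a2 : s₃.arr 2 = s.arr 2 := (hF₃.arr 2 rfl).trans a2
  have a5 : s₃.arr 5 = s₂.arr 5 := hF₃.arr 5 rfl
  replace a8 : s₃.arr 8 = s.arr 8 := (hF₃.arr 8 rfl).trans a8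
  have hL' := hL.split hsplit hact hE
  refine Tr.of_wp (by omega) rfl (by decide) ?_
  simp [r3, r4]
  refine ⟨by omega, ⟨by simpa using r1, by simpa using r2, by simpa using r6,
    by simpa [a5] using hS₂, by simpa [a8] using hd, by simpa using hpos, ?_, ?_⟩⟩
  · simp [r5, ← hsum]; ring
  · simpa [r5, a2, ← two_mul] using hL'

/-- Color the edges level by level. -/
def levels : Program := .loop (.lt (.lit 0) (.reg 3)) (oddStep ;; evenStep)

theorem levels_tr (hw : 4 * m + 4 < 2 ^ w) (hn : 4 * n * m ≤ 2 ^ w) (hΔ : Δ ≤ 2 * m)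
    (hj : 2 * m < 2 ^ j) (hj' : 2 ^ j < 2 ^ w)
    (hv : ∃ β : ℕ → Bool, ∀ i < m, β (v (2 * i)) ≠ β (v (2 * i + 1)))
    (hvn : ∀ h < 2 * m, v h < n) (hs : AtLevel v m Δ j (s.reg 3) s) :
    Tr w levels s ((280 * (m + 1) * (j + 1) + 170 * (m + 1) + 1) * Nat.log 2 (2 * s.reg 3) + 1)
      (fun s' => AtLevel v m Δ j 0 s') := by
  refine Tr.mono (Tr.loop (fun s' => AtLevel v m Δ j (s'.reg 3) s')
    -- The factor `2` makes the potential drop also from `D = 1` to `D = 0`, where `Nat.log 2 D` is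
    -- zero both times.
    (fun s' => Nat.log 2 (2 * s'.reg 3)) hs ?_) le_rfl ?_
  · intro s' _ hI hc
    simp only [Test.Holds, Operand.val, Nat.zero_mod] at hc
    refine Tr.seq (Tr.mono (oddStep_tr hw hΔ hj hj' hv hI) le_rfl ?_)
    rintro s₁ - ⟨h3, h4, hs₁⟩ -
    rw [← h3] at hs₁
    have hK : s₁.reg 4 ≤ Δ := by
      have e1 := hI.sum
      have e2 : s'.reg 4 * 1 ≤ s'.reg 4 * s'.reg 3 := Nat.mul_le_mul_left _ hc
      omega
    refine Tr.mono (evenStep_tr hw hn hΔ hv hvn hK hs₁) le_rfl ?_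
    rintro s₂ - ⟨h3', hs₂⟩
    refine ⟨hs₂, ?_⟩
    rw [h3', h3, Nat.mul_comm 2 (s'.reg 3), Nat.log_mul_base (by omega) (by omega)]
    exact Nat.lt_succ_of_le (Nat.log_mono_right (by omega))
  · rintro s' - ⟨h, hc⟩
    simp only [Test.Holds, Operand.val, Nat.zero_mod, not_lt, Nat.le_zero] at hc
    rwa [hc] at h

end WordRAM

/-! ### Preparing the first level, and the complete coloring program -/

namespace WordRAM

open BalancedSplit

variable {w n m : ℕ} {v : ℕ → ℕ} {s : State}

/-- Copy the endpoints of the edge in register `10` to the half-edges, and make it active. -/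
def inputBody : Program :=
  .arith 13 .mul (.lit 2) (.reg 10) ;;
  .load 14 0 (.reg 10) ;;
  .store 3 (.reg 13) (.reg 14) ;;
  .arith 13 .add (.reg 13) (.lit 1) ;;
  .load 14 1 (.reg 10) ;;
  .store 3 (.reg 13) (.reg 14) ;;
  .store 2 (.reg 10) (.lit 0)

/-- Prepare the first level. -/
def setup : Program :=
  .arith 2 .add (.reg 1) (.reg 1) ;;
  .forUpTo 10 1 inputBody ;;
  .move 6 (.lit 1) ;;
  .loop (.le (.reg 6) (.reg 2)) (.arith 6 .mul (.lit 2) (.reg 6)) ;;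
  degrees ;;
  clearVertices 8 ;;
  .move 3 (.reg 20) ;;
  .move 4 (.lit 1) ;;
  .move 5 (.lit 0)

theorem setup_tr (hw : 8 * m + 8 < 2 ^ w) (h1 : s.reg 1 = m) (h5 : ∀ x, s.arr 5 x = 0)
    (h8 : ∀ x, s.arr 8 x = 0) (hv : ∀ i < m, s.arr 0 i = v (2 * i) ∧ s.arr 1 i = v (2 * i + 1)) :
    Tr w setup s (100 * (m + 1)) (fun s' => ∃ j, 2 * m < 2 ^ j ∧ 2 ^ j ≤ 4 * m + 1 ∧
      AtLevel v m (s'.reg 3) j (s'.reg 3) s' ∧ (∀ x, (halvesAt v m x).card ≤ s'.reg 3) ∧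
      (s'.reg 3 = 0 ∨ ∃ x, (halvesAt v m x).card = s'.reg 3)) := by
  rw [setup]
  refine Tr.mono (b := 1 + ((13 * m + 2) + (1 + ((2 * (2 * m + 1) + 1) + (30 * (m + 1) +
    ((8 * m + 2) + 3)))))) (Tr.seq (Tr.mono (Tr.of_wp (k := 1) (by omega) rfl le_rfl
    (Q := fun s₁ => s₁.reg 1 = m ∧ s₁.reg 2 = 2 * m) ?_) le_rfl ?_)) (by omega) (fun _ _ h => h)
  · simp [h1, two_mul]; omega
  rintro s₁ - ⟨r1, r2⟩ hF₁
  refine Tr.seq ?_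
  rw [← r1]
  refine Tr.mono (Tr.forUpTo (k := 11) (by omega) (fun k s' =>
    (∀ h < 2 * k, s'.arr 3 h = v h) ∧ ∀ i < k, s'.arr 2 i = 0) rfl rfl (by decide) (by omega)
    (by simp) ?_) le_rfl ?_
  · rintro i s' hi hF hr ⟨hI, hI'⟩
    rw [r1] at hi
    have e0 : s'.arr 0 = s.arr 0 := (hF.arr 0 rfl).trans (hF₁.arr 0 rfl)
    have e1 : s'.arr 1 = s.arr 1 := (hF.arr 1 rfl).trans (hF₁.arr 1 rfl)
    obtain ⟨v0, v1⟩ := hv i hi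
    refine Tr.of_wp (by omega) rfl (by decide) ?_
    simp only [inputBody, Program.wp, Operand.ev, Op.Fits, Op.ev, State.setReg_reg,
      State.setReg_arr, State.setArr_reg, State.setArr_arr, if_true, hr, e0, e1]
    refine ⟨by omega, by simp; omega, ?_, ?_⟩
    · intro h hh
      simp [Function.update_apply]
      have := hI h
      split_ifs with c1 c2
      · rw [c1, v1]
      · rw [c2, v0]
      · exact this (by omega)
    · intro l hl
      have := hI' l
      simp [Function.update_apply]
      intro; exact this (by omega)
  rw [r1]
  rintro s₂ _ ⟨h3, h2⟩ hF₂
  replace r2 : s₂.reg 2 = 2 * m := (hF₂.reg 2 rfl).trans r2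
  have f1 : s₂.reg 1 = m := (hF₂.reg 1 rfl).trans r1
  have a5 : s₂.arr 5 = s.arr 5 := (hF₂.arr 5 rfl).trans (hF₁.arr 5 rfl)
  have a8 : s₂.arr 8 = s.arr 8 := (hF₂.arr 8 rfl).trans (hF₁.arr 8 rfl)
  refine Tr.seq (Tr.mono (Tr.of_wp (k := 1) (by omega) rfl le_rfl
    (Q := fun s₃ => s₃ = s₂.setReg 6 1) (by simp)) le_rfl ?_)
  rintro s₃ - rfl -
  refine Tr.seq (Tr.mono (Tr.loop (k := 1) (fun s' => ∃ j, s'.reg 6 = 2 ^ j ∧ 2 ^ j ≤ 4 * m + 1)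
    -- A linear potential is crude for doubling, but `O(m)` steps are affordable here.
    (fun s' => 2 * m + 1 - s'.reg 6) ⟨0, by simp, by simp⟩ ?_) ?_ ?_)
  · rintro s' hF ⟨j, hj, hj'⟩ hc
    have e2 : s'.reg 2 = 2 * m := (hF.reg 2 rfl).trans (by simpa using r2)
    simp only [Test.Holds, Operand.val, e2, hj] at hc
    have hpos : 0 < 2 ^ j := by positivity
    refine Tr.of_wp (by omega) rfl le_rfl ?_
    simp [hj]
    exact ⟨by omega, ⟨j + 1, by ring, by rw [pow_succ]; omega⟩, by omega⟩
  · simp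
  rintro s₄ _ ⟨⟨j, hj, hj'⟩, hc⟩ hF₄
  replace r2 : s₄.reg 2 = 2 * m := (hF₄.reg 2 rfl).trans (by simpa using r2)
  replace f1 : s₄.reg 1 = m := (hF₄.reg 1 rfl).trans (by simpa using f1)
  have b2 : s₄.arr 2 = s₂.arr 2 := hF₄.arr 2 rfl
  have b3 : s₄.arr 3 = s₂.arr 3 := hF₄.arr 3 rfl
  replace a5 : s₄.arr 5 = s.arr 5 := (hF₄.arr 5 rfl).trans a5
  replace a8 : s₄.arr 8 = s.arr 8 := (hF₄.arr 8 rfl).trans a8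
  simp only [Test.Holds, Operand.val, r2, hj, not_le] at hc
  have hcount : ∀ x, colorCount (s₄.arr 3) m (s₄.arr 2) 0 x = (halvesAt v m x).card := by
    intro x
    rw [colorCount, halvesAt]
    congr 1
    refine Finset.filter_congr fun h hh => ?_
    have hh := Finset.mem_range.1 hh
    rw [b3, b2, h3 h hh, h2 _ (by omega)]
    simp
  refine Tr.seq (Tr.mono (degrees_tr (m := m) (by omega) r2 (by rwa [a8])) le_rfl ?_)
  rintro s₅ _ ⟨d1, d2, d3⟩ hF₅
  simp only [hcount] at d1
  simp only [d1] at d2 d3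
  replace r2 : s₅.reg 2 = 2 * m := (hF₅.reg 2 rfl).trans r2
  replace f1 : s₅.reg 1 = m := (hF₅.reg 1 rfl).trans f1
  replace hj : s₅.reg 6 = 2 ^ j := (hF₅.reg 6 rfl).trans hj
  have c2 : s₅.arr 2 = s₄.arr 2 := hF₅.arr 2 rfl
  have c3 : s₅.arr 3 = s₄.arr 3 := hF₅.arr 3 rfl
  replace a5 : s₅.arr 5 = s.arr 5 := (hF₅.arr 5 rfl).trans a5
  refine Tr.seq (Tr.mono (clearVertices_tr (m := m) 8 (by decide) (by omega) r2 ?_) le_rfl ?_)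
  · intro x hx
    rw [d1, ← Nat.pos_iff_ne_zero] at hx
    obtain ⟨h, hh⟩ := Finset.card_pos.1 hx
    simp only [halvesAt, Finset.mem_filter, Finset.mem_range] at hh
    exact ⟨h, hh.1, by rw [c3, b3, h3 h hh.1]; exact hh.2⟩
  intro s₆ _ h8' hF₆
  replace r2 : s₆.reg 2 = 2 * m := (hF₆.reg 2 rfl).trans r2
  replace f1 : s₆.reg 1 = m := (hF₆.reg 1 rfl).trans f1
  replace hj : s₆.reg 6 = 2 ^ j := (hF₆.reg 6 rfl).trans hj
  have r20 : s₆.reg 20 = s₅.reg 20 := hF₆.reg 20 rfl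
  replace c2 : s₆.arr 2 = s₄.arr 2 := (hF₆.arr 2 rfl).trans c2
  replace c3 : s₆.arr 3 = s₄.arr 3 := (hF₆.arr 3 rfl).trans c3
  replace a5 : s₆.arr 5 = s.arr 5 := (hF₆.arr 5 rfl).trans a5
  have hL : Level v m 1 (s₅.reg 20) 0 (s₄.arr 3) (s₄.arr 2) :=
    Level.init (fun i hi => by rw [b2]; exact h2 i hi) (fun h hh => by rw [b3]; exact h3 h hh)
      (fun x => by rw [hcount]; exact d2 x)
  refine Tr.of_wp (by omega) rfl (by decide) ?_
  simp only [Program.wp, Operand.ev]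
  refine ⟨j, hc, hj', ⟨by simpa using f1, by simpa using r2, by simpa using hj,
    by simpa [a5] using h5, by simpa using h8', by simp, by simp, ?_⟩, ?_, ?_⟩
  · simpa [r20, c2, c3] using hL
  · simpa [r20] using d2
  · simpa [r20] using d3

/-- Color the edges of a bipartite graph. -/
def colorBipartite : Program := setup ;; levels

/-- The invariant `K * D + o = Δ` at `D = 0` says that the largest color allowed is `Δ`. One
logarithm in the bound counts the levels, the other the halvings within a matching. -/
theorem colorBipartite_tr (hw : 8 * m + 8 < 2 ^ w) (hn : 4 * n * m ≤ 2 ^ w) (h1 : s.reg 1 = m)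
    (h5 : ∀ x, s.arr 5 x = 0) (h8 : ∀ x, s.arr 8 x = 0)
    (hv : ∀ i < m, s.arr 0 i = v (2 * i) ∧ s.arr 1 i = v (2 * i + 1))
    (hβ : ∃ β : ℕ → Bool, ∀ i < m, β (v (2 * i)) ≠ β (v (2 * i + 1)))
    (hvn : ∀ h < 2 * m, v h < n) :
    Tr w colorBipartite s (600 * (m + 1) * (Nat.log 2 (4 * m + 4) + 1) ^ 2) (fun s' => ∃ Δ,
      (∀ x, (halvesAt v m x).card ≤ Δ) ∧ (Δ = 0 ∨ ∃ x, (halvesAt v m x).card = Δ) ∧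
      (∀ i < m, s'.arr 2 i ≠ 0 ∧ s'.arr 2 i ≤ Δ) ∧
      ∀ h < 2 * m, ∀ g < 2 * m, h / 2 ≠ g / 2 → v h = v g → s'.arr 2 (h / 2) ≠ s'.arr 2 (g / 2)) := by
  set l := Nat.log 2 (4 * m + 4) with hl
  refine Tr.mono (b := 100 * (m + 1) + ((280 * (m + 1) * (l + 1) + 170 * (m + 1) + 1) * l + 1))
    (Tr.seq (Tr.mono (setup_tr hw h1 h5 h8 hv) le_rfl ?_)) ?_ (fun _ _ h => h)
  · rintro s₁ _ ⟨j, hj, hj', hs₁, d1, d2⟩ -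
    have hΔ : s₁.reg 3 ≤ 2 * m := by
      rcases d2 with h | ⟨x, h⟩
      · omega
      · rw [← h]; exact (Finset.card_filter_le _ _).trans (by simp)
    have hjl : j ≤ l := Nat.le_log_of_pow_le (by omega) (by omega)
    have hDl : Nat.log 2 (2 * s₁.reg 3) ≤ l := Nat.log_mono_right (by omega)
    refine Tr.mono (levels_tr (by omega) hn hΔ hj (by omega) hβ hvn hs₁) ?_ ?_
    · gcongr
    · intro s₂ _ hs₂
      have hL := hs₂.level
      have ho : s₂.reg 5 = s₁.reg 3 := by simpa using hs₂.sum
      rw [ho] at hL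
      exact ⟨s₁.reg 3, d1, d2, fun i hi => ⟨hL.colored hi, hL.le i hi⟩,
        fun h hh g hg hne he => hL.valid h hh g hg hne he (hL.colored (by omega))⟩
  · nlinarith [Nat.zero_le (m * l), Nat.zero_le (m * l ^ 2)]

end WordRAM

/-! ### From edge listings to half-edges, and from arrays back to colorings -/

namespace EdgeColoring.EdgeListing

open BalancedSplit

variable {n m μ : ℕ} {G : SimpleGraph (Fin n)} (L : EdgeListing G m)

/-- The vertex of the half-edge `h`. -/
def half (h : ℕ) (hh : h < 2 * m) : Fin n :=
  if h % 2 = 0 then L.fst ⟨h / 2, by omega⟩ else L.snd ⟨h / 2, by omega⟩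

/-- The vertices of the half-edges, as numbers. -/
def vertex (h : ℕ) : ℕ := if hh : h < 2 * m then L.half h hh else 0

theorem vertex_eq {h : ℕ} (hh : h < 2 * m) : L.vertex h = L.half h hh := dif_pos hh

theorem edge_eq_half {h : ℕ} (hh : h < 2 * m) :
    (L.edge ⟨h / 2, by omega⟩ : Sym2 (Fin n)) = s(L.half h hh, L.half (twin h) (twin_lt hh)) := by
  rw [L.edge_eq]
  unfold half
  simp only [twin_div]
  rcases Nat.mod_two_eq_zero_or_one h with e | e
  · rw [if_pos e, if_neg (by unfold twin; omega)]
  · rw [if_neg (by omega), if_pos (by unfold twin; omega), Sym2.eq_swap]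

theorem adj_half {h : ℕ} (hh : h < 2 * m) :
    G.Adj (L.half h hh) (L.half (twin h) (twin_lt hh)) := by
  have := (L.edge ⟨h / 2, by omega⟩).2
  rwa [L.edge_eq_half hh, SimpleGraph.mem_edgeSet] at this

/-- Every endpoint of an edge is the vertex of one of its half-edges. -/
theorem exists_half (i : Fin m) {x : Fin n} (hx : x ∈ (L.edge i : Sym2 (Fin n))) :
    ∃ (h : ℕ) (hh : h < 2 * m), h / 2 = i ∧ L.half h hh = x := by
  have hi := i.2
  rw [L.edge_eq, Sym2.mem_iff] at hx
  rcases hx with rfl | rfl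
  · refine ⟨2 * i, by omega, by omega, ?_⟩
    rw [half, if_pos (by omega)]
    congr 1; ext; simp
  · refine ⟨2 * i + 1, by omega, by omega, ?_⟩
    rw [half, if_neg (by omega)]
    congr 1; ext; simp; omega

/-- The bijection sends a half-edge at `x` to the other endpoint of its edge. It is injective
because an edge is listed once and has no two halves at the same vertex. -/
theorem card_halvesAt [DecidableRel G.Adj] (x : Fin n) :
    (halvesAt L.vertex m x).card = G.degree x := by
  rw [← SimpleGraph.card_neighborFinset_eq_degree]
  have hlt : ∀ h ∈ halvesAt L.vertex m x, h < 2 * m := fun h hh =>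
    Finset.mem_range.1 (Finset.filter_subset _ _ hh)
  have heq : ∀ (h : ℕ) (hh : h ∈ halvesAt L.vertex m x), L.half h (hlt h hh) = x := by
    intro h hh
    have h1 := (Finset.mem_filter.1 hh).2
    rw [L.vertex_eq (hlt h hh)] at h1
    exact Fin.ext h1
  refine Finset.card_bij (fun h hh => L.half (twin h) (twin_lt (hlt h hh))) ?_ ?_ ?_
  · intro h hh
    have := L.adj_half (hlt h hh)
    rw [heq h hh] at this
    simpa using this
  · intro h hh g hg he
    have e1 := L.edge_eq_half (hlt h hh)
    have e2 := L.edge_eq_half (hlt g hg)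
    rw [heq h hh, he] at e1
    rw [heq g hg, ← e1] at e2
    have e3 := L.edge.injective (Subtype.ext e2)
    have e4 : h / 2 = g / 2 := by simpa using e3.symm
    by_contra hne
    have e5 : twin h = g := by unfold twin; omega
    have := L.adj_half (hlt h hh)
    simp only [heq h hh, e5, heq g hg] at this
    exact G.loopless.irrefl _ this
  · intro y hy
    rw [SimpleGraph.mem_neighborFinset] at hy
    set i := L.edge.symm ⟨s(x, y), hy⟩ with hi
    have he : (L.edge i : Sym2 (Fin n)) = s(x, y) := by rw [hi, Equiv.apply_symm_apply]
    obtain ⟨h, hh, h1, h2⟩ := L.exists_half i (x := x) (by rw [he]; simp)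
    have hmem : h ∈ halvesAt L.vertex m x := by
      rw [halvesAt, Finset.mem_filter, Finset.mem_range, L.vertex_eq hh, h2]
      exact ⟨hh, rfl⟩
    refine ⟨h, hmem, ?_⟩
    have e1 := L.edge_eq_half hh
    rw [show (⟨h / 2, by omega⟩ : Fin m) = i from Fin.ext h1, he, h2] at e1
    exact (Sym2.congr_right.1 e1).symm

theorem card_halvesAt_of_le {x : ℕ} (hx : n ≤ x) : (halvesAt L.vertex m x).card = 0 := by
  rw [Finset.card_eq_zero, halvesAt, Finset.filter_eq_empty_iff]
  intro h hh
  rw [L.vertex_eq (Finset.mem_range.1 hh)]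
  have := (L.half h (Finset.mem_range.1 hh)).2
  omega

/-- Identifies the palette size found by the program. The alternative `Δ = 0` covers graphs without
vertices. -/
theorem maxDegree_eq [DecidableRel G.Adj] {Δ : ℕ} (h : ∀ x, (halvesAt L.vertex m x).card ≤ Δ)
    (h' : Δ = 0 ∨ ∃ x, (halvesAt L.vertex m x).card = Δ) : G.maxDegree = Δ := by
  refine le_antisymm (G.maxDegree_le_of_forall_degree_le _ fun x => ?_) ?_
  · rw [← L.card_halvesAt]; exact h x
  · rcases h' with rfl | ⟨x, rfl⟩
    · exact Nat.zero_le _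
    · rcases Nat.lt_or_ge x n with hx | hx
      · have := L.card_halvesAt ⟨x, hx⟩
        simp only at this
        rw [this]
        exact G.degree_le_maxDegree _
      · rw [L.card_halvesAt_of_le hx]; exact Nat.zero_le _

theorem exists_bipartition (hG : G.IsBipartite) :
    ∃ β : ℕ → Bool, ∀ i < m, β (L.vertex (2 * i)) ≠ β (L.vertex (2 * i + 1)) := by
  obtain ⟨c⟩ := hG
  refine ⟨fun x => if hx : x < n then decide (c ⟨x, hx⟩ = 0) else false, fun i hi => ?_⟩
  have h1 := c.valid (L.adj_half (h := 2 * i) (by omega))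
  rw [L.vertex_eq (h := 2 * i) (by omega), L.vertex_eq (h := 2 * i + 1) (by omega)]
  simp only [Fin.is_lt, dif_pos, Fin.eta]
  simp only [show twin (2 * i) = 2 * i + 1 by unfold twin; omega] at h1
  intro h2
  rw [decide_eq_decide] at h2
  omega

/-- The coloring given by an array of positive numbers. -/
def coloring (a : ℕ → ℕ) (ha : ∀ i < m, a i ≠ 0 ∧ a i ≤ μ) : PartialColoring G μ := fun e =>
  some ⟨a (L.edge.symm e) - 1, by have := ha _ (L.edge.symm e).2; omega⟩

theorem isExtension_coloring {a : ℕ → ℕ} (ha : ∀ i < m, a i ≠ 0 ∧ a i ≤ μ)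
    (hv : ∀ h < 2 * m, ∀ g < 2 * m, h / 2 ≠ g / 2 → L.vertex h = L.vertex g →
      a (h / 2) ≠ a (g / 2)) (χ : PartialColoring G μ) :
    IsExtension χ (uncolored χ) (L.coloring a ha) := by
  refine ⟨fun e f hef x hxe hxf b hb hb' => ?_, fun e => ?_⟩
  · obtain ⟨h, hh, h1, h2⟩ := L.exists_half (L.edge.symm e) (x := x) (by simpa using hxe)
    obtain ⟨g, hg, g1, g2⟩ := L.exists_half (L.edge.symm f) (x := x) (by simpa using hxf)
    have hne : h / 2 ≠ g / 2 := by
      rw [h1, g1]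
      exact fun h => hef (L.edge.symm.injective (Fin.ext h))
    refine hv h hh g hg hne (by rw [L.vertex_eq hh, L.vertex_eq hg, h2, g2]) ?_
    have e1 := hb.trans hb'.symm
    simp only [coloring, Option.some.injEq, Fin.mk.injEq] at e1
    have e2 := ha _ (L.edge.symm e).2
    have e3 := ha _ (L.edge.symm f).2
    rw [h1, g1]
    omega
  · simp only [coloring, uncolored, Set.mem_ofPred_eq]
    simp [em']

end EdgeColoring.EdgeListing

/-! ### The logarithmic estimate and the conclusion -/

theorem log_sq_le (m : ℕ) : ((Nat.log 2 (4 * m + 4) + 1 : ℕ) : ℝ) ^ 2 ≤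
    16 / Real.log 2 ^ 2 * Real.log (m + 2) ^ 2 := by
  have h2 : 0 < Real.log 2 := Real.log_pos (by norm_num)
  have h3 : Real.log 2 ≤ Real.log (m + 2) :=
    Real.log_le_log (by norm_num) (by linarith [Nat.cast_nonneg (α := ℝ) m])
  have h4 : (Nat.log 2 (4 * m + 4) : ℝ) ≤ Real.logb 2 ((4 * m + 4 : ℕ) : ℝ) :=
    Real.natLog_le_logb _ _
  have h5 : Real.log ((4 * m + 4 : ℕ) : ℝ) ≤ 2 * Real.log 2 + Real.log (m + 2) := by
    rw [show 2 * Real.log 2 = Real.log 4 by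
      rw [show (4 : ℝ) = 2 ^ 2 by norm_num, Real.log_pow]; norm_num,
      ← Real.log_mul (by norm_num) (by positivity)]
    refine Real.log_le_log (by positivity) ?_
    push_cast; linarith
  have h6 : (Nat.log 2 (4 * m + 4) : ℝ) * Real.log 2 ≤ 2 * Real.log 2 + Real.log (m + 2) := by
    rw [Real.logb, le_div_iff₀ h2] at h4
    exact h4.trans h5
  -- After multiplication by `log 2` the left side is at most `3 * log 2 + log (m + 2)`, and `log 2
  -- ≤ log (m + 2)`.
  have h7 : ((Nat.log 2 (4 * m + 4) + 1 : ℕ) : ℝ) ≤ 4 / Real.log 2 * Real.log (m + 2) := by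
    rw [div_mul_eq_mul_div, le_div_iff₀ h2]
    push_cast
    linarith
  calc ((Nat.log 2 (4 * m + 4) + 1 : ℕ) : ℝ) ^ 2 ≤ (4 / Real.log 2 * Real.log (m + 2)) ^ 2 := by
        gcongr
    _ = _ := by ring

theorem mainTheorem6 :
    ∃ (P : WordRAM.Program) (d k : ℕ) (c C : ℝ), 0 < c ∧ 0 < C ∧
      ∀ (n m : ℕ) (G : SimpleGraph (Fin n)) [DecidableRel G.Adj]
        (L : EdgeColoring.EdgeListing G m)
        (χ : EdgeColoring.PartialColoring G G.maxDegree) (w : ℕ),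
        G.IsBipartite →
        EdgeColoring.Valid χ →
        EdgeColoring.IsMatching (EdgeColoring.uncolored χ) →
        (n + m + 2) ^ d ≤ 2 ^ w →
        ∃ (t : ℕ) (s : WordRAM.State) (χ' : EdgeColoring.PartialColoring G G.maxDegree),
          WordRAM.Run w P (WordRAM.inputState L χ) t s ∧
          WordRAM.Outputs s L χ' ∧
          EdgeColoring.IsExtension χ (EdgeColoring.uncolored χ) χ' ∧
          (t : ℝ) ≤ C * (m + 1) * (2 : ℝ) ^ (c * √(Real.log G.maxDegree)) *
            Real.log (m + 2) ^ k := by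
  have h2 : 0 < Real.log 2 := Real.log_pos (by norm_num)
  -- The exponent `5` yields `8 * m + 8 < 16 * (m + 2) ≤ 2 ^ w` and `4 * n * m ≤ 2 ^ w`. The value
  -- `k = 2` comes from the squared logarithm, and any `c > 0` would do.
  refine ⟨WordRAM.colorBipartite, 5, 2, 1, 600 * (16 / Real.log 2 ^ 2), one_pos, by positivity, ?_⟩
  intro n m G _ L χ w hG _ _ hw
  have hw1 : 8 * m + 8 < 2 ^ w := by
    refine lt_of_lt_of_le ?_ hw
    have e1 : (m + 2) * 2 ^ 4 ≤ (n + m + 2) * (n + m + 2) ^ 4 :=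
      Nat.mul_le_mul (by omega) (Nat.pow_le_pow_left (by omega) 4)
    have e2 : (n + m + 2) * (n + m + 2) ^ 4 = (n + m + 2) ^ 5 := by ring
    omega
  have hw2 : 4 * n * m ≤ 2 ^ w := by
    refine le_trans ?_ hw
    have e1 : (n + m + 2) ^ 2 ≤ (n + m + 2) ^ 5 := Nat.pow_le_pow_right (by omega) (by omega)
    nlinarith [sq_nonneg ((n : ℤ) - m), two_mul_le_add_sq n m]
  obtain ⟨t, s, hrun, ht, Δ, d1, d2, ha, hv⟩ := WordRAM.colorBipartite_tr (n := n)
    (v := L.vertex) (s := WordRAM.inputState L χ) hw1 hw2 (by simp [WordRAM.inputState])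
    (by simp [WordRAM.inputState]) (by simp [WordRAM.inputState])
    (fun i hi => by
      rw [L.vertex_eq (h := 2 * i) (by omega), L.vertex_eq (h := 2 * i + 1) (by omega)]
      simp [WordRAM.inputState, hi, EdgeColoring.EdgeListing.half,
        show (2 * i + 1) / 2 = i by omega, show (2 * i + 1) % 2 = 1 by omega])
    (L.exists_bipartition hG) (fun h hh => by rw [L.vertex_eq hh]; exact (L.half h hh).2)
  obtain rfl := L.maxDegree_eq d1 d2
  refine ⟨t, s, L.coloring _ ha, hrun, fun i => ?_, L.isExtension_coloring ha hv χ, ?_⟩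
  · have := ha i i.2
    simp only [EdgeColoring.EdgeListing.coloring, EdgeColoring.colorCode, Equiv.symm_apply_apply]
    omega
  · have h1 : (1 : ℝ) ≤ (2 : ℝ) ^ (1 * √(Real.log G.maxDegree)) :=
      Real.one_le_rpow (by norm_num) (by positivity)
    have h3 : (0 : ℝ) ≤ 600 * (16 / Real.log 2 ^ 2) * (m + 1) := by positivity
    calc (t : ℝ) ≤ 600 * (m + 1) * ((Nat.log 2 (4 * m + 4) + 1 : ℕ) : ℝ) ^ 2 := by
          exact_mod_cast ht
      _ ≤ 600 * (m + 1) * (16 / Real.log 2 ^ 2 * Real.log (m + 2) ^ 2) := by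
          gcongr
          exact log_sq_le m
      _ = 600 * (16 / Real.log 2 ^ 2) * (m + 1) * 1 * Real.log (m + 2) ^ 2 := by ring
      _ ≤ _ := by gcongr
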